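/- Notation. Let $B_c(0,\rho)$ be the open Euclidean ball of radius $\rho$ centred at $0$ in $\mathbf C^n\cong\mathbf R^{2n}$. For $r>1$ and a holomorphic function $f$ on $B_c(0,r)$, the Chebyshev degree $d_f(r)$ is the optimal (smallest) exponent $d$ such that $$\sup_I|f|\le\left(\frac{4|I|}{|\omega|}\right)^{d}\sup_\omega|f|$$ for every real segment $I\subset B_c(0,1)$ and every measurable $\omega\subset I$ of positive length, where $|\cdot|$ denotes length; that is, $d_f(r)$ is the infimum of all $d>0$ with this property. A function $h:\mathbf R^k\to[0,\infty)$ is log-concave if $\{h>0\}$ is convex and $\log h$ is concave on it; $\mu_h$ is the measure on $\mathbf R^k$ with density $h$. Theorem. There are absolute constants $c_1,c_2,C>0$ (independent of all the data below, in particular of $k$ and $n$) such that the following holds. Let $\mathbf R^k\subset\mathbf C^n$ be a $k$-dimensional real affine subspace, let $V\subset B_c(0,1)\cap\mathbf R^k$ be a $k$-dimensional convex body (a compact convex set with non-empty interior in $\mathbf R^k$), and let $h:\mathbf R^k\to[0,\infty)$ be a log-concave function that vanishes outside $V$, normalized so that $\mu_h(V)=1$. Let $r>1$, let $f$ be a non-constant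 holomorphic function on $B_c(0,r)$, and let $$f_V:=\exp\left(\int_V\log|f|\,d\mu_h\right)$$ be the geometric mean of $|f|$ on $V$ (with $f_V=0$ if the integral is $-\infty$). Then: (1) for every $\alpha>0$, $$\mu_h\{x\in V:\ |f(x)|>\alpha f_V\}\le C\exp\left(-c_1\alpha^{1/d_f(r)}\right);$$ (2) if $f$ does not vanish identically on $V$, then for every $0<\alpha\le e^{-1}$, $$\mu_h\{x\in V:\ |f(x)|\le\alpha f_V\}\le C\,(c_2\alpha)^{1/d_f(r)}\left(\log\frac1\alpha\right)^{1/2}.$$ -/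

import Mathlib

open MeasureTheory Metric Set

noncomputable section

/-- Complex Euclidean space `ℂⁿ`; as a real normed space it is `ℝ²ⁿ`. -/
abbrev CSpace (n : ℕ) := EuclideanSpace ℂ (Fin n)

/-- Real Euclidean space `ℝᵏ`. -/
abbrev RSpace (k : ℕ) := EuclideanSpace ℝ (Fin k)

/-- `f` satisfies the Remez-type inequality with exponent `d` in the open unit ball: for every real
segment `I = [a, b]` in the unit ball and every measurable `ω ⊆ I` of positive length,
`sup_I |f| ≤ (4 |I| / |ω|) ^ d * sup_ω |f|`. The length of `I` is `dist a b`, and the length of `ω`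
is its one-dimensional Hausdorff measure. -/
def RemezBound {n : ℕ} (f : CSpace n → ℂ) (d : ℝ) : Prop :=
  ∀ a b : CSpace n, segment ℝ a b ⊆ ball 0 1 →
    ∀ ω : Set (CSpace n), ω ⊆ segment ℝ a b → MeasurableSet ω → 0 < μH[1] ω →
      sSup ((fun z => ‖f z‖) '' segment ℝ a b) ≤
        (4 * dist a b / (μH[1] ω).toReal) ^ d * sSup ((fun z => ‖f z‖) '' ω)

/-- The Chebyshev degree of `f` in the unit ball: the optimal exponent in the Remez-type
inequality. It depends only on the values of `f` in the unit ball. -/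
def chebyshevDegree {n : ℕ} (f : CSpace n → ℂ) : ℝ :=
  sInf {d : ℝ | 0 < d ∧ RemezBound f d}

/-- A nonnegative function `h` on `ℝᵏ` is log-concave if its support `{h > 0}` is convex and
`log h` is concave there (convexity of the set is part of `ConcaveOn`). -/
def LogConcave {k : ℕ} (h : RSpace k → ℝ) : Prop :=
  (∀ x, 0 ≤ h x) ∧ ConcaveOn ℝ {x | 0 < h x} (fun x => Real.log (h x))

/-- The measure on `ℝᵏ` with density `h` with respect to Lebesgue measure. -/
def densityMeasure {k : ℕ} (h : RSpace k → ℝ) : Measure (RSpace k) :=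
  volume.withDensity (fun x => ENNReal.ofReal (h x))

open Classical in
/-- The geometric mean `exp (∫ log g dμ)` of a bounded nonnegative function `g` with respect to a
probability measure `μ`. As `log g` is bounded above, the integral is either finite
or `-∞`; in the second case (in particular if `g` vanishes on a set of positive measure) the
geometric mean is `exp (-∞) = 0`. -/
def geometricMean {X : Type*} [MeasurableSpace X] (μ : Measure X) (g : X → ℝ) : ℝ :=
  if (∀ᵐ x ∂μ, g x ≠ 0) ∧ Integrable (fun x => Real.log (g x)) μ then
    Real.exp (∫ x, Real.log (g x) ∂μ)
  else 0

end

open scoped ENNReal Pointwise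

/-! The theorem rests on a dilation inequality without dimension: writing `G = |f|` on `V` and `d`
for the Chebyshev degree, `μ{G ≥ β} ≤ 16 exp(-μ{G ≤ α} (β/α)^(1/d) / 96)`. Holomorphy enters only
through continuity and the Remez inequality: on a segment starting at a point where `G ≥ β`, the set
`{G ≤ α}` has proportion at most `δ = 4(α/β)^(1/d)`.

On the line, let `B` have proportion at most `δ` in every interval issuing from `x`. If both tails
of a log-concave probability density at `x` have mass at least `τ`, comparison with exponentials
gives `B` mass `O(δ log(1/τ))`. Hence a set `S` of such points lies where one tail is exponentially
small in `ν(B)/δ` (`IsLogConcave.measure_le_exp`).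

The passage to dimension `k` is a localization by bisection. Were the inequality false, convex
bodies could be cut repeatedly so that the proportion of `{G ≤ α}` is kept and that of `{G ≥ β}`
stays too large, until the body is nearly a segment (`IsNeedleBody.exists_thin`). Prékopa's theorem
makes the projection of the measure to that segment log-concave, and uniform continuity makes `G`
almost constant on the fibres, so the one-dimensional case gives a contradiction
(`HasRemezDegree.measure_le`).

Finally, take one threshold to be a median `m`. This gives both tails of `G/m`, so `log(G/m)/d` has
mean bounded by an absolute constant. The geometric mean is thus `m exp(dE)` with `|E|` bounded, and
the exponent `1/d` turns `exp(dE)` into `exp(E)`: replacing `m` by the geometric mean costs an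
absolute constant. The lower tail obtained is linear in `α^(1/d)`, without the logarithmic factor.
-/

/-- Multiplicative form of log-concavity for functions with values in `[0, ∞]`. -/
def IsLogConcave {E : Type*} [AddCommGroup E] [Module ℝ E] (h : E → ℝ≥0∞) : Prop :=
  ∀ x y : E, ∀ a b : ℝ, 0 < a → 0 < b → a + b = 1 → h x ^ a * h y ^ b ≤ h (a • x + b • y)

/-! ### Brunn–Minkowski and Prékopa–Leindler on the line -/

lemma volume_add_le_of_isCompact {A B C : Set ℝ} (hA : IsCompact A) (hB : IsCompact B)
    (hA' : A.Nonempty) (hB' : B.Nonempty) {a b : ℝ} (ha : 0 < a) (hb : 0 < b)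
    (hC : ∀ x ∈ A, ∀ y ∈ B, a * x + b * y ∈ C) :
    ENNReal.ofReal a * volume A + ENNReal.ofReal b * volume B ≤ volume C := by
  obtain ⟨p, hpA, hp⟩ := hA.exists_isGreatest hA'
  obtain ⟨q, hqB, hq⟩ := hB.exists_isLeast hB'
  -- Since `p = max A` and `q = min B`, these translates of `aA` and `bB` meet at most in the point
  -- `ap + bq`, and both lie in `C`; their lengths therefore add up.
  set A' := (fun x => a * x + b * q) '' A
  set B' := (fun y => a * p + b * y) '' B
  have hA1 : volume A' = ENNReal.ofReal a * volume A := by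
    have : A' = (fun x => x + b * q) '' (a • A) := by
      rw [← image_smul, image_image]; rfl
    rw [this, image_add_right, measure_preimage_add_right, Measure.addHaar_smul]
    simp [abs_of_pos ha]
  have hB1 : volume B' = ENNReal.ofReal b * volume B := by
    have : B' = (fun y => a * p + y) '' (b • B) := by
      rw [← image_smul, image_image]; rfl
    rw [this, image_add_left, measure_preimage_add, Measure.addHaar_smul]
    simp [abs_of_pos hb]
  have hint : A' ∩ B' ⊆ {a * p + b * q} := by
    rintro z ⟨⟨x, hx, rfl⟩, ⟨y, hy, hxy⟩⟩
    have h1 : a * x ≤ a * p := by gcongr; exact hp hx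
    have h2 : b * q ≤ b * y := by gcongr; exact hq hy
    simp only at hxy
    simp only [mem_singleton_iff]; linarith
  have hB'm : MeasurableSet B' := (hB.image (by fun_prop)).measurableSet
  calc _ = volume A' + volume B' := by rw [hA1, hB1]
    _ = volume (A' ∪ B') + volume (A' ∩ B') := (measure_union_add_inter _ hB'm).symm
    _ = volume (A' ∪ B') := by
        rw [measure_mono_null hint (measure_singleton _), add_zero]
    _ ≤ volume C := by
        apply measure_mono
        rintro z (⟨x, hx, rfl⟩ | ⟨y, hy, rfl⟩)
        · exact hC _ hx _ hqB
        · exact hC _ hpA _ hy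

/-- One-dimensional Brunn–Minkowski inequality. -/
lemma volume_add_le {A B C : Set ℝ} (hA : MeasurableSet A) (hB : MeasurableSet B)
    (hA' : A.Nonempty) (hB' : B.Nonempty) {a b : ℝ} (ha : 0 < a) (hb : 0 < b)
    (hC : ∀ x ∈ A, ∀ y ∈ B, a * x + b * y ∈ C) :
    ENNReal.ofReal a * volume A + ENNReal.ofReal b * volume B ≤ volume C := by
  obtain ⟨x₀, hx₀⟩ := hA'
  obtain ⟨y₀, hy₀⟩ := hB'
  have key : ∀ K ⊆ A, IsCompact K → ∀ L ⊆ B, IsCompact L →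
      ENNReal.ofReal a * volume K + ENNReal.ofReal b * volume L ≤ volume C := by
    intro K hK hKc L hL hLc
    -- Adjoining `x₀` and `y₀` makes the compact sets nonempty, so that `K` and `L` may be empty.
    refine le_trans ?_ (volume_add_le_of_isCompact (hKc.insert x₀) (hLc.insert y₀)
      (insert_nonempty _ _) (insert_nonempty _ _) ha hb (C := C) ?_)
    · gcongr <;> exact subset_insert _ _
    · intro x hx y hy
      exact hC x (insert_subset hx₀ hK hx) y (insert_subset hy₀ hL hy)
  rw [hA.measure_eq_iSup_isCompact, hB.measure_eq_iSup_isCompact]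
  simp_rw [ENNReal.mul_iSup]
  have h1 : ∀ K ⊆ A, IsCompact K → ENNReal.ofReal a * volume K + ENNReal.ofReal b *
      (⨆ L, ⨆ (_ : L ⊆ B), ⨆ (_ : IsCompact L), volume L) ≤ volume C := by
    intro K hK hKc
    simp_rw [ENNReal.mul_iSup]
    rw [ENNReal.add_biSup' (p := fun L => L ⊆ B) ⟨∅, empty_subset _⟩]
    refine iSup₂_le fun L hL => ?_
    by_cases hLc : IsCompact L
    · simpa [hLc] using key K hK hKc L hL hLc
    · simpa [hLc] using key K hK hKc ∅ (empty_subset _) isCompact_empty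
  simp_rw [ENNReal.mul_iSup] at h1
  rw [ENNReal.biSup_add' (p := fun K => K ⊆ A) ⟨∅, empty_subset _⟩]
  refine iSup₂_le fun K hK => ?_
  by_cases hKc : IsCompact K
  · simpa [hKc] using h1 K hK hKc
  · simpa [hKc] using h1 ∅ (empty_subset _) isCompact_empty

lemma ENNReal.rpow_mul_rpow_le_add {a b : ℝ} (ha : 0 < a) (hb : 0 < b) (hab : a + b = 1)
    (x y : ℝ≥0∞) : x ^ a * y ^ b ≤ ENNReal.ofReal a * x + ENNReal.ofReal b * y := by
  rcases eq_or_ne x ⊤ with rfl | hx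
  · rw [ENNReal.mul_top (by simpa using ha)]; simp
  rcases eq_or_ne y ⊤ with rfl | hy
  · rw [ENNReal.mul_top (by simpa using hb)]; simp
  lift x to NNReal using hx
  lift y to NNReal using hy
  lift a to NNReal using ha.le
  lift b to NNReal using hb.le
  rw [ENNReal.rpow_ofNNReal a.coe_nonneg, ENNReal.rpow_ofNNReal b.coe_nonneg]
  have := NNReal.geom_mean_le_arith_mean2_weighted a b x y (by exact_mod_cast hab)
  simp only [ENNReal.ofReal_coe_nnreal]
  exact_mod_cast this

/-- One-dimensional Prékopa–Leindler inequality for functions with supremum `1`. -/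
lemma lintegral_add_le_of_sup_one {f g w : ℝ → ℝ} (hf : Measurable f) (hg : Measurable g)
    (hw : Measurable w) (hf0 : ∀ x, 0 ≤ f x) (hg0 : ∀ x, 0 ≤ g x) (hw0 : ∀ x, 0 ≤ w x)
    (hf1 : ∀ x, f x ≤ 1) (hg1 : ∀ x, g x ≤ 1)
    (hfs : ∀ c < 1, ∃ x, c < f x) (hgs : ∀ c < 1, ∃ x, c < g x)
    {a b : ℝ} (ha : 0 < a) (hb : 0 < b) (hab : a + b = 1)
    (h : ∀ x y, f x ^ a * g y ^ b ≤ w (a * x + b * y)) :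
    ENNReal.ofReal a * (∫⁻ x, ENNReal.ofReal (f x)) +
      ENNReal.ofReal b * (∫⁻ x, ENNReal.ofReal (g x)) ≤ ∫⁻ x, ENNReal.ofReal (w x) := by
  rw [lintegral_eq_lintegral_meas_lt volume (f := f) (Filter.Eventually.of_forall hf0) hf.aemeasurable,
    lintegral_eq_lintegral_meas_lt volume (f := g) (Filter.Eventually.of_forall hg0) hg.aemeasurable,
    lintegral_eq_lintegral_meas_lt volume (f := w) (Filter.Eventually.of_forall hw0) hw.aemeasurable]
  have hm : ∀ f : ℝ → ℝ, Measurable fun t : ℝ => volume {x | t < f x} := fun f =>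
    Antitone.measurable fun s t hst => measure_mono fun x (hx : t < f x) => lt_of_le_of_lt hst hx
  rw [← lintegral_const_mul _ (hm f), ← lintegral_const_mul _ (hm g), ← lintegral_add_left
    ((hm f).const_mul _)]
  refine setLIntegral_mono' measurableSet_Ioi fun t (ht : 0 < t) => ?_
  -- Layer by layer: below level `1` both superlevel sets are nonempty because the suprema equal
  -- `1`, so Brunn–Minkowski applies; from level `1` on they are empty.
  by_cases ht1 : t < 1
  · refine volume_add_le (measurableSet_lt measurable_const hf)
      (measurableSet_lt measurable_const hg) (hfs t ht1) (hgs t ht1) ha hb ?_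
    intro x hx y hy
    refine lt_of_lt_of_le ?_ (h x y)
    calc t = t ^ a * t ^ b := by rw [← Real.rpow_add ht, hab, Real.rpow_one]
      _ < f x ^ a * g y ^ b := by
        have h1 := Real.rpow_lt_rpow ht.le hx ha
        have h2 := Real.rpow_lt_rpow ht.le hy hb
        have := Real.rpow_pos_of_pos ht a
        have := Real.rpow_pos_of_pos ht b
        gcongr
  · have h1 : {x | t < f x} = ∅ := by
      ext x; simpa using (hf1 x).trans (not_lt.1 ht1)
    have h2 : {x | t < g x} = ∅ := by
      ext x; simpa using (hg1 x).trans (not_lt.1 ht1)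
    simp [h1, h2]

/-- One-dimensional Prékopa–Leindler inequality for bounded functions. -/
lemma lintegral_rpow_mul_le_of_bounded {f g w : ℝ → ℝ≥0∞} (hf : Measurable f) (hg : Measurable g)
    (hw : Measurable w) {M : ℝ≥0∞} (hM : M ≠ ⊤) (hfM : ∀ x, f x ≤ M) (hgM : ∀ x, g x ≤ M)
    (hwM : ∀ x, w x ≤ M) {a b : ℝ} (ha : 0 < a) (hb : 0 < b) (hab : a + b = 1)
    (h : ∀ x y, f x ^ a * g y ^ b ≤ w (a * x + b * y)) :
    (∫⁻ x, f x) ^ a * (∫⁻ x, g x) ^ b ≤ ∫⁻ x, w x := by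
  set F := ⨆ x, f x
  set G := ⨆ x, g x
  have hFt : F ≠ ⊤ := ((iSup_le hfM).trans_lt hM.lt_top).ne
  have hGt : G ≠ ⊤ := ((iSup_le hgM).trans_lt hM.lt_top).ne
  by_cases hF0 : F = 0
  · have : ∀ x, f x = 0 := by simpa [F] using hF0
    simp [this, ENNReal.zero_rpow_of_pos ha]
  by_cases hG0 : G = 0
  · have : ∀ x, g x = 0 := by simpa [G] using hG0
    simp [this, ENNReal.zero_rpow_of_pos hb]
  -- The hypothesis is homogeneous: dividing `f`, `g`, `w` by `F`, `G`, `F ^ a * G ^ b` preserves it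
  -- and brings the suprema to `1`. The additive inequality then yields the multiplicative one by
  -- the weighted mean inequality.
  set H := F ^ a * G ^ b
  have hFa0 : F ^ a ≠ 0 := by simp [hF0, hFt]
  have hGb0 : G ^ b ≠ 0 := by simp [hG0, hGt]
  have hFat : F ^ a ≠ ⊤ := ENNReal.rpow_ne_top_of_nonneg ha.le hFt
  have hGbt : G ^ b ≠ ⊤ := ENNReal.rpow_ne_top_of_nonneg hb.le hGt
  have hH0 : H ≠ 0 := mul_ne_zero hFa0 hGb0
  have hHt : H ≠ ⊤ := ENNReal.mul_ne_top hFat hGbt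
  have main : ∀ (u : ℝ → ℝ≥0∞) (U : ℝ≥0∞), Measurable u → (∀ x, u x ≤ M) → U ≠ 0 → U ≠ ⊤ →
      ∫⁻ x, u x = U * ∫⁻ x, ENNReal.ofReal (u x / U).toReal := by
    intro u U hu huM hU0 hUt
    rw [← lintegral_const_mul _ (by fun_prop)]
    refine lintegral_congr fun x => ?_
    rw [ENNReal.ofReal_toReal (ENNReal.div_ne_top ((huM x).trans_lt hM.lt_top).ne hU0),
      ENNReal.mul_div_cancel hU0 hUt]
  have sup_one : ∀ (u : ℝ → ℝ≥0∞), (∀ x, u x ≤ M) → (⨆ x, u x) ≠ 0 → (⨆ x, u x) ≠ ⊤ →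
      (∀ x, (u x / ⨆ x, u x).toReal ≤ 1) ∧ ∀ c < 1, ∃ x, c < (u x / ⨆ x, u x).toReal := by
    intro u huM h0 ht
    have hle : ∀ x, u x / (⨆ x, u x) ≤ 1 := fun x =>
      ENNReal.div_le_of_le_mul (by simpa using le_iSup u x)
    refine ⟨fun x => ENNReal.toReal_le_of_le_ofReal zero_le_one (by simpa using hle x), ?_⟩
    intro c hc
    have : ENNReal.ofReal c * (⨆ x, u x) < ⨆ x, u x := by
      conv_rhs => rw [← one_mul (⨆ x, u x)]
      exact ENNReal.mul_lt_mul_left h0 ht (by simpa using hc)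
    obtain ⟨x, hx⟩ := lt_iSup_iff.1 this
    refine ⟨x, ?_⟩
    rcases lt_or_ge c 0 with hc0 | hc0
    · exact hc0.trans_le ENNReal.toReal_nonneg
    rw [← ENNReal.ofReal_lt_iff_lt_toReal hc0 ((hle x).trans_lt ENNReal.one_lt_top).ne,
      ENNReal.lt_div_iff_mul_lt (.inl h0) (.inl ht)]
    exact hx
  obtain ⟨hf1, hfs⟩ := sup_one f hfM hF0 hFt
  obtain ⟨hg1, hgs⟩ := sup_one g hgM hG0 hGt
  rw [main f F hf hfM hF0 hFt, main g G hg hgM hG0 hGt, main w H hw hwM hH0 hHt,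
    ENNReal.mul_rpow_of_nonneg _ _ ha.le, ENNReal.mul_rpow_of_nonneg _ _ hb.le,
    mul_mul_mul_comm]
  refine mul_le_mul_right ((ENNReal.rpow_mul_rpow_le_add ha hb hab _ _).trans
    (lintegral_add_le_of_sup_one (f := fun x => (f x / F).toReal)
      (g := fun x => (g x / G).toReal) (w := fun x => (w x / H).toReal)
      (by fun_prop) (by fun_prop) (by fun_prop) (fun _ => ENNReal.toReal_nonneg)
      (fun _ => ENNReal.toReal_nonneg) (fun _ => ENNReal.toReal_nonneg) hf1 hg1 hfs hgs ha hb hab ?_)) H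
  intro x y
  rw [ENNReal.toReal_rpow, ENNReal.toReal_rpow, ← ENNReal.toReal_mul,
    ENNReal.div_rpow_of_nonneg _ _ ha.le, ENNReal.div_rpow_of_nonneg _ _ hb.le,
    ← ENNReal.mul_div_mul_comm (.inl hFa0) (.inl hFat)]
  refine ENNReal.toReal_mono (ENNReal.div_ne_top ((hwM _).trans_lt hM.lt_top).ne hH0) ?_
  gcongr
  exact h x y

/-- One-dimensional Prékopa–Leindler inequality. -/
lemma lintegral_rpow_mul_le {f g w : ℝ → ℝ≥0∞} (hf : Measurable f) (hg : Measurable g)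
    (hw : Measurable w) {a b : ℝ} (ha : 0 < a) (hb : 0 < b) (hab : a + b = 1)
    (h : ∀ x y, f x ^ a * g y ^ b ≤ w (a * x + b * y)) :
    (∫⁻ x, f x) ^ a * (∫⁻ x, g x) ^ b ≤ ∫⁻ x, w x := by
  have trunc : ∀ u : ℝ → ℝ≥0∞, Measurable u →
      ∫⁻ x, u x = ⨆ n : ℕ, ∫⁻ x, min (u x) n := by
    intro u hu
    rw [← lintegral_iSup (fun n => hu.min measurable_const) ?_]
    · refine lintegral_congr fun x => ?_
      refine le_antisymm ?_ (iSup_le fun n => min_le_left _ _)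
      rw [← inf_iSup_eq, ENNReal.iSup_natCast, inf_top_eq]
    · intro m n hmn x
      exact min_le_min_left _ (by exact_mod_cast hmn)
  -- Truncating all three functions at `n` keeps the hypothesis, because `n ^ a * n ^ b = n`.
  have step : ∀ n : ℕ, (∫⁻ x, min (f x) n) ^ a * (∫⁻ x, min (g x) n) ^ b ≤ ∫⁻ x, w x := by
    intro n
    refine (lintegral_rpow_mul_le_of_bounded (w := fun x => min (w x) n) (M := n)
      (hf.min measurable_const) (hg.min measurable_const) (hw.min measurable_const)
      (ENNReal.natCast_ne_top n) (fun x => min_le_right _ _) (fun x => min_le_right _ _)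
      (fun x => min_le_right _ _) ha hb hab ?_).trans (lintegral_mono fun x => min_le_left _ _)
    intro x y
    refine le_min ((mul_le_mul' ?_ ?_).trans (h x y)) ?_
    · exact ENNReal.rpow_le_rpow (min_le_left _ _) ha.le
    · exact ENNReal.rpow_le_rpow (min_le_left _ _) hb.le
    · calc min (f x) n ^ a * min (g y) n ^ b ≤ (n : ℝ≥0∞) ^ a * (n : ℝ≥0∞) ^ b :=
            mul_le_mul' (ENNReal.rpow_le_rpow (min_le_right _ _) ha.le)
              (ENNReal.rpow_le_rpow (min_le_right _ _) hb.le)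
        _ = n := by rw [← ENNReal.rpow_add_of_nonneg _ _ ha.le hb.le, hab, ENNReal.rpow_one]
  have mono : ∀ u : ℝ → ℝ≥0∞, Monotone fun n : ℕ => ∫⁻ x, min (u x) n := fun u m n hmn =>
    lintegral_mono fun x => min_le_min_left _ (by exact_mod_cast hmn)
  rw [trunc f hf, trunc g hg, ← ENNReal.orderIsoRpow_apply a ha, ← ENNReal.orderIsoRpow_apply b hb,
    OrderIso.map_iSup, OrderIso.map_iSup, ENNReal.iSup_mul]
  simp_rw [ENNReal.mul_iSup]
  refine iSup₂_le fun m n => (mul_le_mul' ?_ ?_).trans (step (max m n))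
  · exact (ENNReal.orderIsoRpow a ha).monotone (mono f (le_max_left m n))
  · exact (ENNReal.orderIsoRpow b hb).monotone (mono g (le_max_right m n))

/-! ### Log-concave functions and their marginals -/

namespace IsLogConcave

variable {E F : Type*} [AddCommGroup E] [Module ℝ E] [AddCommGroup F] [Module ℝ F]

lemma comp_affine {h : E → ℝ≥0∞} (hh : IsLogConcave h) (φ : F → E)
    (hφ : ∀ x y, ∀ a b : ℝ, a + b = 1 → φ (a • x + b • y) = a • φ x + b • φ y) :
    IsLogConcave (fun x => h (φ x)) := by
  intro x y a b ha hb hab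
  simp only [hφ x y a b hab]
  exact hh _ _ a b ha hb hab

lemma convex_lt {h : E → ℝ≥0∞} (hh : IsLogConcave h) (c : ℝ≥0∞) : Convex ℝ {x | c < h x} := by
  rw [convex_iff_forall_pos]
  intro x hx y hy a b ha hb hab
  refine lt_of_lt_of_le ?_ (hh x y a b ha hb hab)
  simp only [mem_ofPred_eq] at hx hy
  calc c = c ^ a * c ^ b := by
        rw [← ENNReal.rpow_add_of_nonneg _ _ ha.le hb.le, hab, ENNReal.rpow_one]
    _ < h x ^ a * h y ^ b :=
        ENNReal.mul_lt_mul (ENNReal.rpow_lt_rpow hx ha) (ENNReal.rpow_lt_rpow hy hb)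

lemma indicator {h : E → ℝ≥0∞} (hh : IsLogConcave h) {K : Set E} (hK : Convex ℝ K) :
    IsLogConcave (K.indicator h) := by
  intro x y a b ha hb hab
  by_cases hx : x ∈ K
  · by_cases hy : y ∈ K
    · rw [indicator_of_mem hx, indicator_of_mem hy, indicator_of_mem (hK hx hy ha.le hb.le hab)]
      exact hh x y a b ha hb hab
    · simp [indicator_of_notMem hy, ENNReal.zero_rpow_of_pos hb]
  · simp [indicator_of_notMem hx, ENNReal.zero_rpow_of_pos ha]

lemma measurable {h : ℝ → ℝ≥0∞} (hh : IsLogConcave h) : Measurable h :=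
  measurable_of_Ioi fun c => (hh.convex_lt c).ordConnected.measurableSet

lemma aemeasurable {E : Type*} [NormedAddCommGroup E] [NormedSpace ℝ E] [MeasurableSpace E]
    [BorelSpace E] [FiniteDimensional ℝ E] {μ : Measure E} [μ.IsAddHaarMeasure]
    {h : E → ℝ≥0∞} (hh : IsLogConcave h) : AEMeasurable h μ := by
  have : @Measurable (NullMeasurableSpace E μ) _ _ _ h :=
    measurable_of_Ioi fun c => (hh.convex_lt c).nullMeasurableSet μ
  exact NullMeasurable.aemeasurable this

lemma lintegral_real {h : E × ℝ → ℝ≥0∞} (hh : IsLogConcave h) :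
    IsLogConcave (fun x => ∫⁻ t, h (x, t)) := by
  have hs : ∀ x, Measurable fun t => h (x, t) := fun x =>
    (hh.comp_affine (fun t : ℝ => (x, t)) fun s t a b hab => by
      simp [← add_smul, hab]).measurable
  intro x y a b ha hb hab
  refine lintegral_rpow_mul_le (hs x) (hs y) (hs _) ha hb hab fun s t => ?_
  exact hh (x, s) (y, t) a b ha hb hab

/-- Marginals of a log-concave function are log-concave. -/
theorem lintegral_pi : ∀ (m : ℕ) {E : Type} [AddCommGroup E] [Module ℝ E]
    {h : E × (Fin m → ℝ) → ℝ≥0∞}, IsLogConcave h → IsLogConcave (fun x => ∫⁻ y, h (x, y)) := by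
  intro m
  induction m with
  | zero =>
    intro E _ _ h hh
    have : (fun x => ∫⁻ y, h (x, y)) = fun x => h (x, 0) := by
      ext x
      rw [Measure.volume_pi_eq_dirac 0, lintegral_dirac]
    rw [this]
    exact hh.comp_affine (fun x => (x, 0)) (by simp)
  | succ m ih =>
    intro E _ _ h hh
    have key : ∀ x, ∫⁻ y, h (x, y) = ∫⁻ t : ℝ, ∫⁻ z : Fin m → ℝ, h (x, Fin.cons t z) := by
      intro x
      have hx : AEMeasurable (fun y => h (x, y)) volume :=
        (hh.comp_affine (fun y => (x, y)) fun s t a b hab => by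
          simp [← add_smul, hab]).aemeasurable
      have e := (volume_preserving_piFinSuccAbove (fun _ : Fin (m + 1) => ℝ) 0).symm
      rw [← e.map_eq, lintegral_map_equiv, Measure.volume_eq_prod, lintegral_prod]
      · simp [MeasurableEquiv.piFinSuccAbove, Fin.insertNthEquiv]
      · rw [← e.map_eq] at hx
        exact hx.comp_measurable (MeasurableEquiv.measurable _)
    simp_rw [key]
    -- The inner `m` coordinates are integrated by the induction hypothesis with parameter space `E
    -- × ℝ`; the remaining real coordinate is the one-dimensional case. This is why `E` varies in
    -- the induction.
    refine lintegral_real (h := fun p : E × ℝ => ∫⁻ z : Fin m → ℝ, h (p.1, Fin.cons p.2 z)) ?_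
    refine ih (h := fun p : (E × ℝ) × (Fin m → ℝ) => h (p.1.1, Fin.cons p.1.2 p.2)) ?_
    refine hh.comp_affine (fun p : (E × ℝ) × (Fin m → ℝ) =>
      (p.1.1, (Fin.cons p.1.2 p.2 : Fin (m + 1) → ℝ))) ?_
    intro x y a b hab
    refine Prod.ext (by simp) ?_
    ext i
    refine Fin.cases ?_ (fun j => ?_) i <;> simp

end IsLogConcave

/-! ### The dilation inequality on the line -/

lemma measure_setOf_measure_Iic_le (ν : Measure ℝ) [IsFiniteMeasure ν] (t : ℝ≥0∞) :
    ν {x | ν (Iic x) ≤ t} ≤ t := by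
  have hm : MeasurableSet {x | ν (Iic x) ≤ t} := by
    refine IsLowerSet.ordConnected (fun x y hyx hx => ?_) |>.measurableSet
    exact (measure_mono (Iic_subset_Iic.2 hyx)).trans hx
  -- A nonempty compact subset `K` lies in `Iic (max K)`, and `max K` itself belongs to the set; no
  -- quantile has to be chosen.
  rw [hm.measure_eq_iSup_isCompact]
  refine iSup₂_le fun K hK => iSup_le fun hKc => ?_
  rcases K.eq_empty_or_nonempty with rfl | hne
  · simp
  obtain ⟨x, hx, hmax⟩ := hKc.exists_isGreatest hne
  exact (measure_mono hmax).trans (hK hx)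

lemma measure_setOf_measure_Ici_le (ν : Measure ℝ) [IsFiniteMeasure ν] (t : ℝ≥0∞) :
    ν {x | ν (Ici x) ≤ t} ≤ t := by
  have hm : MeasurableSet {x | ν (Ici x) ≤ t} := by
    refine IsUpperSet.ordConnected (fun x y hyx hx => ?_) |>.measurableSet
    exact (measure_mono (Ici_subset_Ici.2 hyx)).trans hx
  rw [hm.measure_eq_iSup_isCompact]
  refine iSup₂_le fun K hK => iSup_le fun hKc => ?_
  rcases K.eq_empty_or_nonempty with rfl | hne
  · simp
  obtain ⟨x, hx, hmin⟩ := hKc.exists_isLeast hne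
  exact (measure_mono hmin).trans (hK hx)

namespace IsLogConcave

/-- An infinite value at `x` and a nonzero value at some `y ≠ x` force the value `∞` on the whole
open segment between them, which has positive length. If no such `y` exists, the integral is zero.
-/
lemma ne_top_of_lintegral {h : ℝ → ℝ≥0∞} (hh : IsLogConcave h) (h0 : ∫⁻ x, h x ≠ 0)
    (ht : ∫⁻ x, h x ≠ ⊤) (x : ℝ) : h x ≠ ⊤ := by
  intro hx
  have : ∃ y, y ≠ x ∧ h y ≠ 0 := by
    by_contra! hc
    apply h0
    rw [lintegral_eq_zero_iff hh.measurable]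
    have : ∀ᵐ y : ℝ, y ≠ x := by simp [ae_iff]
    filter_upwards [this] with y hy using hc y hy
  obtain ⟨y, hyx, hy⟩ := this
  have key : ∀ a ∈ Ioo (0 : ℝ) 1, h (a * x + (1 - a) * y) = ⊤ := by
    intro a ha
    have := hh x y a (1 - a) ha.1 (by linarith [ha.2]) (by ring)
    rw [hx, ENNReal.top_rpow_of_pos ha.1, ENNReal.top_mul] at this
    · simpa using this
    · simp [hy, ha.2.le]
  have hsub : (fun a => a * x + (1 - a) * y) '' Ioo 0 1 ⊆ {z | h z = ⊤} := by
    rintro _ ⟨a, ha, rfl⟩; exact key a ha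
  have hnull : volume {z | h z = ⊤} = 0 := by
    have := ae_lt_top hh.measurable ht
    rw [ae_iff] at this
    simpa using this
  have himg : (fun a => a * x + (1 - a) * y) '' Ioo 0 1 =
      (fun z => y + z) '' ((x - y) • Ioo (0:ℝ) 1) := by
    rw [← image_smul, image_image]
    refine image_congr fun a _ => ?_
    simp only [smul_eq_mul]; ring
  have := measure_mono_null hsub hnull
  rw [himg, image_add_left, measure_preimage_add, Measure.addHaar_smul] at this
  simp [sub_eq_zero, hyx.symm] at this

end IsLogConcave

/-- Multiplicative form of log-concavity for real functions on the line. -/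
def IsRealLogConcave (ρ : ℝ → ℝ) : Prop :=
  (∀ x, 0 ≤ ρ x) ∧
    ∀ x y a b : ℝ, 0 < a → 0 < b → a + b = 1 → ρ x ^ a * ρ y ^ b ≤ ρ (a * x + b * y)

namespace IsRealLogConcave

variable {ρ : ℝ → ℝ}

lemma of_toReal {h : ℝ → ℝ≥0∞} (hh : IsLogConcave h) (ht : ∀ x, h x ≠ ⊤) :
    IsRealLogConcave fun x => (h x).toReal := by
  refine ⟨fun x => ENNReal.toReal_nonneg, fun x y a b ha hb hab => ?_⟩
  rw [ENNReal.toReal_rpow, ENNReal.toReal_rpow, ← ENNReal.toReal_mul]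
  exact ENNReal.toReal_mono (ht _) (hh x y a b ha hb hab)

lemma comp_neg (h : IsRealLogConcave ρ) : IsRealLogConcave fun x => ρ (-x) := by
  refine ⟨fun x => h.1 _, fun x y a b ha hb hab => ?_⟩
  have := h.2 (-x) (-y) a b ha hb hab
  rwa [show a * -x + b * -y = -(a * x + b * y) by ring] at this

lemma convex_lt (h : IsRealLogConcave ρ) {t : ℝ} (ht : 0 ≤ t) : Convex ℝ {x | t < ρ x} := by
  rw [convex_iff_forall_pos]
  intro x (hx : t < ρ x) y (hy : t < ρ y) a b ha hb hab
  refine lt_of_lt_of_le ?_ (h.2 x y a b ha hb hab)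
  have h1 := Real.rpow_lt_rpow ht hx ha
  have h2 := Real.rpow_lt_rpow ht hy hb
  calc t = t ^ a * t ^ b := by
        rw [← Real.rpow_add_of_nonneg ht ha.le hb.le, hab, Real.rpow_one]
    _ < ρ x ^ a * ρ y ^ b := mul_lt_mul'' h1 h2 (Real.rpow_nonneg ht _) (Real.rpow_nonneg ht _)

/-- On the segment between `x` and `s` the function dominates the exponential interpolating it. -/
lemma exp_le (h : IsRealLogConcave ρ) {x s κ : ℝ} (hxs : x < s) (hx : 0 < ρ x)
    (hs : ρ s = ρ x * Real.exp (κ * (s - x))) {u : ℝ} (hxu : x ≤ u) (hus : u ≤ s) :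
    ρ x * Real.exp (κ * (u - x)) ≤ ρ u := by
  rcases hxu.eq_or_lt with rfl | hxu
  · simp
  rcases hus.eq_or_lt with rfl | hus
  · exact hs.ge
  have hL : 0 < s - x := sub_pos.2 hxs
  have key := h.2 x s ((s - u) / (s - x)) ((u - x) / (s - x)) (div_pos (by linarith) hL)
    (div_pos (by linarith) hL) (by field_simp; ring)
  have h1 : (s - u) / (s - x) * x + (u - x) / (s - x) * s = u := by field_simp; ring
  rw [h1, hs, Real.mul_rpow hx.le (Real.exp_pos _).le, ← mul_assoc, ← Real.rpow_add hx,
    show (s - u) / (s - x) + (u - x) / (s - x) = 1 by field_simp; ring, Real.rpow_one,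
    ← Real.exp_mul, show κ * (s - x) * ((u - x) / (s - x)) = κ * (u - x) by field_simp] at key
  exact key

/-- To the left of `x` the function is dominated by the exponential interpolating it at `x`
and `s`. -/
lemma le_exp (h : IsRealLogConcave ρ) {x s κ : ℝ} (hxs : x < s) (hx : 0 < ρ x)
    (hs : ρ s = ρ x * Real.exp (κ * (s - x))) {u : ℝ} (hux : u < x) :
    ρ u ≤ ρ x * Real.exp (κ * (u - x)) := by
  rcases (h.1 u).eq_or_lt with hu | hu
  · rw [← hu]; positivity
  have hL : 0 < s - u := by linarith
  have key := h.2 u s ((s - x) / (s - u)) ((x - u) / (s - u)) (div_pos (by linarith) hL)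
    (div_pos (by linarith) hL) (by field_simp; ring)
  have h1 : (s - x) / (s - u) * u + (x - u) / (s - u) * s = x := by field_simp; ring
  rw [h1] at key
  have hspos : 0 < ρ s := by rw [hs]; positivity
  have key2 := Real.log_le_log (by positivity) key
  rw [Real.log_mul (by positivity) (by positivity), Real.log_rpow hu, Real.log_rpow hspos, hs,
    Real.log_mul hx.ne' (Real.exp_pos _).ne', Real.log_exp] at key2
  rw [← Real.log_le_log_iff hu (by positivity), Real.log_mul hx.ne' (Real.exp_pos _).ne',
    Real.log_exp]
  have h2 : (s - x) * Real.log (ρ u) + (x - u) * (Real.log (ρ x) + κ * (s - x)) ≤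
      (s - u) * Real.log (ρ x) := by
    have := mul_le_mul_of_nonneg_left key2 hL.le
    field_simp at this
    linarith
  have h3 : (s - x) * Real.log (ρ u) ≤ (s - x) * (Real.log (ρ x) + κ * (u - x)) := by
    linarith
  exact le_of_mul_le_mul_left h3 (by linarith)

/-- Quantitative control of a log-concave density to the right of a point with left tail `τ`. -/
lemma mul_le_of_tail (h : IsRealLogConcave ρ) (hi : Integrable ρ) (h1 : ∫ x, ρ x ≤ 1) {x s τ : ℝ}
    (hτ : 0 < τ) (hx : τ ≤ ∫ u in Iic x, ρ u) (hxs : x < s) :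
    (s - x) * ρ s ≤ 1 + Real.log (1 + 1 / τ) ∧ ρ s ≤ (1 + 1 / τ) * ρ x := by
  have hτ' : 0 < 1 / τ := by positivity
  have hlog : 0 ≤ Real.log (1 + 1 / τ) := Real.log_nonneg (by linarith)
  have hL : 0 < s - x := sub_pos.2 hxs
  rcases (h.1 s).eq_or_lt with hs0 | hs0
  · rw [← hs0, mul_zero]
    exact ⟨by linarith, mul_nonneg (by linarith) (h.1 x)⟩
  have hIic : ∃ u, u < x ∧ 0 < ρ u := by
    by_contra! hc
    have : ∫ u in Iic x, ρ u = 0 := by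
      rw [integral_Iic_eq_integral_Iio]
      refine setIntegral_eq_zero_of_forall_eq_zero fun u hu => le_antisymm (hc u hu) (h.1 u)
    linarith
  obtain ⟨u, hux, hu⟩ := hIic
  have hx0 : 0 < ρ x :=
    ((h.convex_lt le_rfl).ordConnected.out hu hs0) ⟨hux.le, hxs.le⟩
  have hle1 : ∀ S : Set ℝ, ∫ u in S, ρ u ≤ 1 := fun S =>
    (setIntegral_le_integral hi (.of_forall h.1)).trans h1
  -- If `ρ s ≤ ρ x`, convexity of superlevel sets gives `ρ ≥ ρ s` on `[x, s]`, and the total mass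
  -- bounds `(s - x) ρ s` by `1`. Otherwise take the exponential of rate `κ` through the values at
  -- `x` and `s`: it majorizes `ρ` left of `x`, whence `τ ≤ ρ x / κ`, and minorizes it on `[x, s]`,
  -- whence `ρ s - ρ x ≤ κ`.
  rcases le_or_gt (ρ s) (ρ x) with hsx | hsx
  · refine ⟨?_, by nlinarith⟩
    have : (s - x) * ρ s ≤ ∫ u in Icc x s, ρ u := by
      calc (s - x) * ρ s = ∫ u in Icc x s, ρ s := by
            simp [hL.le, Measure.real]
        _ ≤ _ := by
            refine setIntegral_mono_on (by simp) hi.integrableOn measurableSet_Icc fun u hu => ?_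
            by_contra! hlt
            have hc := (h.convex_lt (h.1 u)).ordConnected.out (x := x) (hlt.trans_le hsx) hlt
            exact lt_irrefl (ρ u) (hc hu)
    linarith [hle1 (Icc x s)]
  · set κ := Real.log (ρ s / ρ x) / (s - x)
    have hK : 0 < Real.log (ρ s / ρ x) := Real.log_pos (by rwa [one_lt_div hx0])
    have hκ : 0 < κ := by positivity
    have hκL : κ * (s - x) = Real.log (ρ s / ρ x) := by simp only [κ]; field_simp
    have hs : ρ s = ρ x * Real.exp (κ * (s - x)) := by
      rw [hκL, Real.exp_log (by positivity)]; field_simp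
    have hexp : ∀ c, IntegrableOn (fun u => ρ x * Real.exp (κ * (u - x))) (Iic c) ∧
        ∫ u in Iic c, ρ x * Real.exp (κ * (u - x)) = ρ x * Real.exp (κ * (c - x)) / κ := by
      intro c
      have he : ∀ u, ρ x * Real.exp (κ * (u - x)) =
          (ρ x * Real.exp (-κ * x)) * Real.exp (κ * u) := by
        intro u
        rw [mul_assoc, ← Real.exp_add]; congr 2; ring
      simp_rw [he]
      refine ⟨(integrableOn_exp_mul_Iic hκ c).const_mul _, ?_⟩
      rw [integral_const_mul, integral_exp_mul_Iic hκ]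
      ring
    have hleft : τ ≤ ρ x / κ := by
      refine hx.trans ?_
      have := (hexp x).2
      rw [sub_self, mul_zero, Real.exp_zero, mul_one] at this
      rw [← this]
      refine setIntegral_mono_on hi.integrableOn (hexp x).1 measurableSet_Iic fun u hu => ?_
      rcases (mem_Iic.1 hu).eq_or_lt with rfl | hu
      · simp
      · exact h.le_exp hxs hx0 hs hu
    have hright : (ρ s - ρ x) / κ ≤ 1 := by
      calc (ρ s - ρ x) / κ = ∫ u in Ioc x s, ρ x * Real.exp (κ * (u - x)) := by
            rw [show Ioc x s = Iic s \ Iic x by ext; simp [and_comm],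
              setIntegral_sdiff measurableSet_Iic (hexp s).1 (Iic_subset_Iic.2 hxs.le),
              (hexp s).2, (hexp x).2, ← hs]
            simp; ring
        _ ≤ ∫ u in Ioc x s, ρ u := by
            refine setIntegral_mono_on ((hexp s).1.mono_set fun u hu => hu.2) hi.integrableOn
              measurableSet_Ioc fun u hu => h.exp_le hxs hx0 hs hu.1.le hu.2
        _ ≤ 1 := hle1 _
    rw [le_div_iff₀ hκ] at hleft
    rw [div_le_iff₀ hκ, one_mul] at hright
    have hτκ : κ ≤ 1 / τ * ρ x := by
      rw [div_mul_eq_mul_div, le_div_iff₀ hτ]; linarith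
    have hb : ρ s ≤ (1 + 1 / τ) * ρ x := by linarith
    refine ⟨?_, hb⟩
    have hK2 : κ * (s - x) ≤ Real.log (1 + 1 / τ) := by
      rw [hκL]
      exact Real.log_le_log (by positivity) (by rwa [div_le_iff₀ hx0])
    have hexp1 : κ * (s - x) + 1 ≤ Real.exp (κ * (s - x)) := Real.add_one_le_exp _
    have : ρ x * (κ * (s - x)) ≤ κ := by nlinarith
    have h5 : ρ x * (s - x) ≤ 1 := by
      by_contra! hc
      nlinarith
    nlinarith


lemma setLIntegral_indicator_const {c r : ℝ} :
    ∫⁻ t in Ioi (0 : ℝ), (Iio c).indicator (fun _ => ENNReal.ofReal r) t =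
      ENNReal.ofReal r * ENNReal.ofReal c := by
  rw [lintegral_indicator_const measurableSet_Iio, Measure.restrict_apply measurableSet_Iio,
    Iio_inter_Ioi, Real.volume_Ioo, sub_zero]

/-- A set that has proportion at most `δ` in every interval `[x, y]` has small mass to the right
of `x`. -/
lemma setLIntegral_Ici_le (h : IsRealLogConcave ρ) (hi : Integrable ρ) (h1 : ∫ x, ρ x ≤ 1)
    {x τ δ : ℝ} (hτ : 0 < τ) (hx : τ ≤ ∫ u in Iic x, ρ u) (hδ : 0 < δ) {B : Set ℝ}
    (hB : MeasurableSet B)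
    (hBx : ∀ y, x ≤ y → volume (B ∩ Icc x y) ≤ ENNReal.ofReal (δ * (y - x))) :
    ∫⁻ u in B ∩ Ici x, ENNReal.ofReal (ρ u) ≤
      ENNReal.ofReal (δ * (4 + 3 * Real.log (1 + 1 / τ))) := by
  set Q := 1 + Real.log (1 + 1 / τ)
  have hτ' : 0 < 1 / τ := by positivity
  have hlog : 0 ≤ Real.log (1 + 1 / τ) := Real.log_nonneg (by linarith)
  have hQ1 : 1 ≤ Q := by simp only [Q]; linarith
  have hQ : ∀ s, x ≤ s → (s - x) * ρ s ≤ Q := by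
    intro s hs
    rcases hs.eq_or_lt with rfl | hs
    · simp; linarith
    · exact (h.mul_le_of_tail hi h1 hτ hx hs).1
  have hbd : ∀ s, x ≤ s → ρ s ≤ (1 + 1 / τ) * ρ x := by
    intro s hs
    rcases hs.eq_or_lt with rfl | hs
    · nlinarith [h.1 x]
    · exact (h.mul_le_of_tail hi h1 hτ hx hs).2
  by_cases hz : ∀ s, x ≤ s → ρ s = 0
  · rw [setLIntegral_congr_fun (g := fun _ => 0) (hB.inter measurableSet_Ici)]
    · simp
    · intro u hu; simp [hz u hu.2]
  push Not at hz
  -- The supremum of `ρ` over `[x, ∞)` need not be attained; a point with more than half of it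
  -- serves as approximate mode.
  obtain ⟨s, hxs, hs0, hmax⟩ : ∃ s, x ≤ s ∧ 0 < ρ s ∧ ∀ y, x ≤ y → ρ y < 2 * ρ s := by
    have hbdd : BddAbove (ρ '' Ici x) := by
      refine ⟨(1 + 1 / τ) * ρ x, ?_⟩
      rintro _ ⟨y, hy, rfl⟩; exact hbd y hy
    obtain ⟨z, hxz, hz⟩ := hz
    have hzpos : 0 < ρ z := lt_of_le_of_ne (h.1 z) (Ne.symm hz)
    have hle : ∀ y, x ≤ y → ρ y ≤ sSup (ρ '' Ici x) := fun y hy => le_csSup hbdd ⟨y, hy, rfl⟩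
    have hP : 0 < sSup (ρ '' Ici x) := hzpos.trans_le (hle z hxz)
    obtain ⟨_, ⟨s, hs, rfl⟩, hlt⟩ := exists_lt_of_lt_csSup (s := ρ '' Ici x) ⟨_, z, hxz, rfl⟩
      (half_lt_self hP)
    exact ⟨s, hs, by linarith, fun y hy => by linarith [hle y hy]⟩
  have hρm : AEMeasurable ρ (volume.restrict (B ∩ Ici x)) := hi.aemeasurable.restrict
  have hρm' : AEMeasurable ρ (volume.restrict (Ici s)) := hi.aemeasurable.restrict
  rw [lintegral_eq_lintegral_meas_lt (volume.restrict (B ∩ Ici x)) (f := ρ)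
    (Filter.Eventually.of_forall h.1) hρm]
  have hlev : ∀ t : ℝ, 0 ≤ t → MeasurableSet {u | t < ρ u} := fun t ht =>
    (h.convex_lt ht).ordConnected.measurableSet
  -- If `{ρ > t}` reaches at most distance `R` to the right of `x`, then `B` has length at most `δR`
  -- there.
  have cover : ∀ t R : ℝ, 0 < t → (∀ y, x ≤ y → t < ρ y → y - x ≤ R) →
      volume.restrict (B ∩ Ici x) {u | t < ρ u} ≤ ENNReal.ofReal δ * ENNReal.ofReal R := by
    intro t R ht hR
    rw [Measure.restrict_apply (hlev t ht.le)]
    rcases ({u | t < ρ u} ∩ (B ∩ Ici x)).eq_empty_or_nonempty with he | ⟨y₀, hy₀⟩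
    · simp [he]
    have hR0 : 0 ≤ R := by
      have := hR y₀ hy₀.2.2 hy₀.1
      have := mem_Ici.1 hy₀.2.2
      linarith
    rw [← ENNReal.ofReal_mul hδ.le]
    have := hBx (x + R) (by linarith)
    rw [add_sub_cancel_left] at this
    refine (measure_mono ?_).trans this
    rintro y ⟨hy, hyB, hxy⟩
    exact ⟨hyB, hxy, by linarith [hR y hxy hy]⟩
  -- Below level `ρ s` the reach is at most `s - x` plus the length of the level set beyond `s`;
  -- between `ρ s` and `2ρ s` it is at most `Q / ρ s`; higher levels are empty. Integrated over `t`,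
  -- these give at most `Q + 1 + 2Q`.
  have key : ∀ t ∈ Ioi (0 : ℝ), volume.restrict (B ∩ Ici x) {u | t < ρ u} ≤
      ENNReal.ofReal δ * ((Iio (ρ s)).indicator (fun _ => ENNReal.ofReal (s - x)) t +
        (volume.restrict (Ici s) {u | t < ρ u} +
          (Iio (2 * ρ s)).indicator (fun _ => ENNReal.ofReal (Q / ρ s)) t)) := by
    intro t (ht : 0 < t)
    by_cases hts : t < ρ s
    · rw [indicator_of_mem (by exact hts)]
      refine le_trans ?_ (mul_le_mul_right (add_le_add_right le_self_add _) _)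
      rw [Measure.restrict_apply (s := Ici s) (hlev t ht.le)]
      by_cases htop : volume ({u | t < ρ u} ∩ Ici s) = ⊤
      · rw [htop, add_top, ENNReal.mul_top (by simpa using hδ)]; exact le_top
      have hv := ENNReal.ofReal_toReal htop
      rw [← hv, ← ENNReal.ofReal_add (by linarith) ENNReal.toReal_nonneg]
      refine cover t _ ht fun y hxy hy => ?_
      rcases le_or_gt y s with hys | hys
      · linarith [ENNReal.toReal_nonneg (a := volume ({u | t < ρ u} ∩ Ici s))]
      · have hsub : Icc s y ⊆ {u | t < ρ u} ∩ Ici s := fun u hu =>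
          ⟨(h.convex_lt ht.le).ordConnected.out (by exact hts) (by exact hy) hu, hu.1⟩
        have := measure_mono (μ := volume) hsub
        rw [Real.volume_Icc, ENNReal.ofReal_le_iff_le_toReal htop] at this
        linarith
    · by_cases hts2 : t < 2 * ρ s
      · rw [indicator_of_mem (s := Iio (2 * ρ s)) (by exact hts2)]
        refine le_trans (cover t (Q / ρ s) ht fun y hxy hy => ?_)
          (mul_le_mul_right (le_add_self.trans le_add_self) _)
        rw [le_div_iff₀ hs0]
        refine le_trans ?_ (hQ y hxy)
        gcongr
        linarith
      · have : {u | t < ρ u} ∩ (B ∩ Ici x) = ∅ := by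
          ext y
          simp only [mem_inter_iff, mem_empty_iff_false, iff_false]
          rintro ⟨hy, -, hxy⟩
          have hy : t < ρ y := hy
          linarith [hmax y hxy]
        rw [Measure.restrict_apply (hlev t ht.le), this]
        simp
  refine (setLIntegral_mono' measurableSet_Ioi key).trans ?_
  have hanti : Measurable fun t : ℝ => volume.restrict (Ici s) {u | t < ρ u} :=
    Antitone.measurable fun a b hab => measure_mono fun u (hu : b < ρ u) => lt_of_le_of_lt hab hu
  have hm1 : Measurable ((Iio (ρ s)).indicator fun _ : ℝ => ENNReal.ofReal (s - x)) :=
    measurable_const.indicator measurableSet_Iio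
  have hm2 : Measurable ((Iio (2 * ρ s)).indicator fun _ : ℝ => ENNReal.ofReal (Q / ρ s)) :=
    measurable_const.indicator measurableSet_Iio
  rw [lintegral_const_mul _ (by fun_prop), lintegral_add_left hm1, lintegral_add_left hanti,
    setLIntegral_indicator_const, setLIntegral_indicator_const,
    ← lintegral_eq_lintegral_meas_lt (volume.restrict (Ici s)) (f := ρ)
      (Filter.Eventually.of_forall h.1) hρm', ← ENNReal.ofReal_mul (by linarith),
    ← ENNReal.ofReal_mul (by positivity),
    ← ofReal_integral_eq_lintegral_ofReal hi.restrict (.of_forall h.1),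
    ← ENNReal.ofReal_add (setIntegral_nonneg measurableSet_Ici fun u _ => h.1 u) (by positivity),
    ← ENNReal.ofReal_add (mul_nonneg (by linarith) hs0.le)
      (add_nonneg (setIntegral_nonneg measurableSet_Ici fun u _ => h.1 u) (by positivity)),
    ← ENNReal.ofReal_mul hδ.le]
  apply ENNReal.ofReal_le_ofReal
  refine mul_le_mul_of_nonneg_left ?_ hδ.le
  have e1 : ∫ u in Ici s, ρ u ≤ 1 := (setIntegral_le_integral hi (.of_forall h.1)).trans h1
  have e2 : Q / ρ s * (2 * ρ s) = 2 * Q := by field_simp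
  rw [e2]
  have := hQ s hxs
  simp only [Q] at *
  linarith

/-- The part of `B` to the left of `x` is treated by reflection, which doubles the one-sided bound.
-/
lemma setLIntegral_le (h : IsRealLogConcave ρ) (hi : Integrable ρ) (h1 : ∫ x, ρ x ≤ 1)
    {x τ δ : ℝ} (hτ : 0 < τ) (hx : τ ≤ ∫ u in Iic x, ρ u) (hx' : τ ≤ ∫ u in Ici x, ρ u)
    (hδ : 0 < δ) {B : Set ℝ} (hB : MeasurableSet B)
    (hBx : ∀ y, volume (B ∩ uIcc x y) ≤ ENNReal.ofReal (δ * |y - x|)) :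
    ∫⁻ u in B, ENNReal.ofReal (ρ u) ≤
      ENNReal.ofReal (δ * (8 + 6 * Real.log (1 + 1 / τ))) := by
  have r := h.setLIntegral_Ici_le hi h1 hτ hx hδ hB fun y hy => by
    have := hBx y
    rwa [uIcc_of_le hy, abs_of_nonneg (by linarith)] at this
  have l := h.comp_neg.setLIntegral_Ici_le (x := -x) (B := -B) hi.comp_neg
    (by rw [integral_neg_eq_self]; exact h1) hτ
    (by rw [integral_comp_neg_Iic, neg_neg, ← integral_Ici_eq_integral_Ioi]; exact hx')
    hδ hB.neg fun y hy => by
    have := hBx (-y)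
    rw [uIcc_of_ge (by linarith), abs_of_nonpos (by linarith), ← Measure.measure_neg, inter_neg,
      neg_Icc, neg_neg] at this
    convert this using 3
    ring
  have l' : ∫⁻ u in B ∩ Iic x, ENNReal.ofReal (ρ u) ≤
      ENNReal.ofReal (δ * (4 + 3 * Real.log (1 + 1 / τ))) := by
    refine le_trans (le_of_eq ?_) l
    rw [← (Measure.measurePreserving_neg (volume : Measure ℝ)).setLIntegral_comp_preimage_emb
      (MeasurableEquiv.neg ℝ).measurableEmbedding]
    congr 2
    ext u
    simp
  have hlog : 0 ≤ Real.log (1 + 1 / τ) := Real.log_nonneg (by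
    have : 0 < 1 / τ := by positivity
    linarith)
  calc ∫⁻ u in B, ENNReal.ofReal (ρ u)
      ≤ ∫⁻ u in (B ∩ Ici x) ∪ (B ∩ Iic x), ENNReal.ofReal (ρ u) := by
        refine lintegral_mono_set fun u hu => ?_
        rcases le_total x u with hxu | hxu
        · exact .inl ⟨hu, hxu⟩
        · exact .inr ⟨hu, hxu⟩
    _ ≤ _ := lintegral_union_le _ _ _
    _ ≤ _ := add_le_add r l'
    _ = _ := by
        rw [← ENNReal.ofReal_add (by positivity) (by positivity)]
        congr 1; ring

end IsRealLogConcave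

/-- Dilation inequality for log-concave probability densities on the line. -/
theorem IsLogConcave.measure_le_exp {h : ℝ → ℝ≥0∞} (hh : IsLogConcave h) (h1 : ∫⁻ x, h x = 1)
    {δ : ℝ} (hδ : 0 < δ) {B S : Set ℝ} (hB : MeasurableSet B)
    (hBS : ∀ x ∈ S, ∀ y, volume (B ∩ uIcc x y) ≤ ENNReal.ofReal (δ * |y - x|)) :
    volume.withDensity h S ≤
      ENNReal.ofReal (16 * Real.exp (-((volume.withDensity h B).toReal / δ) / 6)) := by
  set ν := volume.withDensity h with hν
  have htop := hh.ne_top_of_lintegral (by simp [h1]) (by simp [h1])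
  set ρ := fun x => (h x).toReal
  have hρ : IsRealLogConcave ρ := .of_toReal hh htop
  have hρh : ∀ x, ENNReal.ofReal (ρ x) = h x := fun x => ENNReal.ofReal_toReal (htop x)
  have hi : Integrable ρ := integrable_toReal_of_lintegral_ne_top hh.measurable.aemeasurable
    (by simp [h1])
  have hprob : IsProbabilityMeasure ν := ⟨by simp [ν, h1]⟩
  have hint : ∀ T, MeasurableSet T → ν T = ENNReal.ofReal (∫ u in T, ρ u) := by
    intro T hT
    rw [ofReal_integral_eq_lintegral_ofReal hi.restrict (.of_forall hρ.1), hν,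
      withDensity_apply _ hT]
    simp_rw [hρh]
  have hi1 : ∫ x, ρ x = 1 := by
    have := hint univ MeasurableSet.univ
    rw [measure_univ, Measure.restrict_univ, eq_comm, ENNReal.ofReal_eq_one] at this
    exact this
  set v := (ν B).toReal
  -- This `t₀` solves `v / δ = 8 + 6 (log 2 - log t₀)`. As `1 + 1/τ ≤ 2/τ`, a point of `S` with both
  -- tails above `t₀` would violate `setLIntegral_le`.
  set t₀ := 2 * Real.exp (-(v / δ - 8) / 6)
  have hsub : S ⊆ {x | ν (Iic x) ≤ ENNReal.ofReal t₀} ∪ {x | ν (Ici x) ≤ ENNReal.ofReal t₀} := by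
    intro x hx
    by_contra hc
    simp only [mem_union, mem_ofPred_eq, not_or, not_le] at hc
    obtain ⟨hc1, hc2⟩ := hc
    rw [hint _ measurableSet_Iic] at hc1
    rw [hint _ measurableSet_Ici] at hc2
    have hc1 := (ENNReal.ofReal_lt_ofReal_iff'.mp hc1).1
    have hc2 := (ENNReal.ofReal_lt_ofReal_iff'.mp hc2).1
    set τ := min (∫ u in Iic x, ρ u) (∫ u in Ici x, ρ u)
    have hτt : t₀ < τ := lt_min hc1 hc2
    have hτ : 0 < τ := lt_trans (by positivity) hτt
    have hτ1 : τ ≤ 1 := (min_le_left _ _).trans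
      ((setIntegral_le_integral hi (.of_forall hρ.1)).trans hi1.le)
    have := hρ.setLIntegral_le hi hi1.le hτ (min_le_left _ _) (min_le_right _ _) hδ hB (hBS x hx)
    simp_rw [hρh] at this
    rw [← withDensity_apply _ hB, ← hν] at this
    have hv : v ≤ δ * (8 + 6 * Real.log (1 + 1 / τ)) := by
      refine ENNReal.toReal_le_of_le_ofReal (mul_nonneg hδ.le ?_) this
      have : 0 ≤ Real.log (1 + 1 / τ) := Real.log_nonneg (by
        have : 0 < 1 / τ := by positivity
        linarith)
      linarith
    have hlog : Real.log (1 + 1 / τ) ≤ Real.log 2 - Real.log τ := by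
      rw [← Real.log_div (by norm_num) hτ.ne']
      refine Real.log_le_log (by positivity) ?_
      rw [le_div_iff₀ hτ, add_mul, one_div_mul_cancel hτ.ne']
      linarith
    have hlt := Real.log_lt_log (by positivity) hτt
    simp only [t₀] at hlt
    rw [Real.log_mul (by norm_num) (Real.exp_pos _).ne', Real.log_exp] at hlt
    have : v / δ ≤ 8 + 6 * Real.log (1 + 1 / τ) := by
      rw [div_le_iff₀ hδ]; linarith
    linarith
  calc ν S ≤ _ := measure_mono hsub
    _ ≤ _ := measure_union_le _ _
    _ ≤ ENNReal.ofReal t₀ + ENNReal.ofReal t₀ :=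
        add_le_add (measure_setOf_measure_Iic_le ν _) (measure_setOf_measure_Ici_le ν _)
    _ = ENNReal.ofReal (t₀ + t₀) := (ENNReal.ofReal_add (by positivity) (by positivity)).symm
    _ ≤ _ := by
        apply ENNReal.ofReal_le_ofReal
        have e : Real.exp (-(v / δ - 8) / 6) = Real.exp (4 / 3) * Real.exp (-(v / δ) / 6) := by
          rw [← Real.exp_add]; congr 1; ring
        have e2 : Real.exp (4 / 3) ≤ 4 := by
          have : (4 / 3 : ℝ) ≤ Real.log 4 := by
            rw [show (4 : ℝ) = 2 ^ 2 by norm_num, Real.log_pow]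
            have := Real.log_two_gt_d9
            push_cast; linarith
          calc _ ≤ Real.exp (Real.log 4) := Real.exp_le_exp.2 this
            _ = 4 := Real.exp_log (by norm_num)
        simp only [t₀, e]
        have := Real.exp_pos (-(v / δ) / 6)
        nlinarith

/-! ### Localization: bisection down to thin convex bodies -/

section Localization

variable {k : ℕ}

lemma volume_hyperplane_eq_zero {i j : Fin k} (hij : i ≠ j) {c s : ℝ} (hcs : c ^ 2 + s ^ 2 = 1)
    (p q : ℝ) : volume {x : RSpace k | c * (x i - p) + s * (x j - q) = 0} = 0 := by
  set l : RSpace k →ₗ[ℝ] ℝ :=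
    c • (EuclideanSpace.proj i : RSpace k →L[ℝ] ℝ).toLinearMap +
      s • (EuclideanSpace.proj j : RSpace k →L[ℝ] ℝ).toLinearMap with hl
  have hlx : ∀ x, l x = c * x i + s * x j := fun x => by simp [hl]
  set A := (AffineSubspace.mk' (c * p + s * q) (⊥ : Submodule ℝ ℝ)).comap l.toAffineMap
  have hA : {x : RSpace k | c * (x i - p) + s * (x j - q) = 0} = A := by
    ext x
    simp only [A, AffineSubspace.coe_comap, mem_preimage, SetLike.mem_coe,
      AffineSubspace.mem_mk', Submodule.mem_bot, LinearMap.coe_toAffineMap, vsub_eq_sub, hlx,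
      mem_ofPred_eq]
    constructor <;> intro h <;> linarith
  rw [hA]
  refine Measure.addHaar_affineSubspace _ _ fun htop => ?_
  set y : RSpace k := EuclideanSpace.single i (p + c) + EuclideanSpace.single j (q + s) with hy
  have hyA : y ∈ (A : Set (RSpace k)) := by rw [htop]; trivial
  rw [← hA] at hyA
  have h1 : y i = p + c := by simp [hy, hij]
  have h2 : y j = q + s := by simp [hy, hij.symm]
  have hyA : c * (y i - p) + s * (y j - q) = 0 := hyA
  rw [h1, h2] at hyA
  nlinarith

/-- A convex body with the bisection constraints used in the localization argument. -/
structure IsNeedleBody (μ : Measure (RSpace k)) (w₁ w₂ : RSpace k → ℝ) (K : Set (RSpace k)) :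
    Prop where
  isCompact : IsCompact K
  convex : Convex ℝ K
  integral_eq : ∫ x in K, w₁ x ∂μ = 0
  integral_pos : 0 < ∫ x in K, w₂ x ∂μ

variable {μ : Measure (RSpace k)} {w₁ w₂ : RSpace k → ℝ}

/-- A half-space is rotated about the flat `x i = p`, `x j = q`. Since hyperplanes are null, the
integral of `w₁` over its part of `K` is continuous in the angle, and the values at `0` and `π` are
opposite. Some angle thus bisects the constraint on `w₁`, and one of the two halves keeps a positive
integral of `w₂`. -/
lemma IsNeedleBody.exists_halfSpace (hμ : μ ≪ volume) (h₁ : Integrable w₁ μ)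
    (h₂ : Integrable w₂ μ) {K : Set (RSpace k)} (hK : IsNeedleBody μ w₁ w₂ K) {i j : Fin k}
    (hij : i ≠ j) (p q : ℝ) :
    ∃ K' ⊆ K, IsNeedleBody μ w₁ w₂ K' ∧ ∃ c s : ℝ, c ^ 2 + s ^ 2 = 1 ∧
      ∀ x ∈ K', 0 ≤ c * (x i - p) + s * (x j - q) := by
  set L : ℝ → RSpace k → ℝ := fun θ x => Real.cos θ * (x i - p) + Real.sin θ * (x j - q) with hL
  have hLx : ∀ θ, Continuous (L θ) := fun θ => by simp only [hL]; fun_prop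
  have hLθ : ∀ x, Continuous fun θ => L θ x := fun x => by simp only [hL]; fun_prop
  have hcs : ∀ θ, Real.cos θ ^ 2 + Real.sin θ ^ 2 = 1 := Real.cos_sq_add_sin_sq
  have hnull : ∀ θ, μ {x | L θ x = 0} = 0 := fun θ =>
    hμ (volume_hyperplane_eq_zero hij (hcs θ) p q)
  have hHm : ∀ θ, MeasurableSet {x | 0 ≤ L θ x} := fun θ =>
    (isClosed_le continuous_const (hLx θ)).measurableSet
  have hLneg : ∀ θ x, L (θ + Real.pi) x = -L θ x := fun θ x => by
    simp only [hL, Real.cos_add_pi, Real.sin_add_pi]; ring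
  have hsplit : ∀ (w : RSpace k → ℝ), Integrable w μ → ∀ θ,
      ∫ x in K ∩ {x | 0 ≤ L θ x}, w x ∂μ + ∫ x in K ∩ {x | 0 ≤ L (θ + Real.pi) x}, w x ∂μ =
        ∫ x in K, w x ∂μ := by
    intro w hw θ
    rw [← integral_inter_add_sdiff (μ := μ) (s := K) (hHm θ) hw.integrableOn]
    congr 1
    refine setIntegral_congr_set ?_
    have : ∀ᵐ x ∂μ, L θ x ≠ 0 := by rw [ae_iff]; simpa using hnull θ
    filter_upwards [this] with x hx
    refine propext ⟨?_, ?_⟩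
    · rintro ⟨hxK, (hx' : 0 ≤ L (θ + Real.pi) x)⟩
      rw [hLneg] at hx'
      refine ⟨hxK, fun (hx'' : 0 ≤ L θ x) => hx (le_antisymm (by linarith) hx'')⟩
    · rintro ⟨hxK, hx'⟩
      refine ⟨hxK, ?_⟩
      have hx' : ¬ 0 ≤ L θ x := hx'
      change 0 ≤ L (θ + Real.pi) x
      rw [hLneg]; linarith
  set g : ℝ → ℝ := fun θ => ∫ x in K ∩ {x | 0 ≤ L θ x}, w₁ x ∂μ with hg
  have hgc : Continuous g := by
    have hg' : g = fun θ => ∫ x in K, ({x | 0 ≤ L θ x}.indicator w₁) x ∂μ := by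
      ext θ
      rw [setIntegral_indicator (hHm θ)]
    rw [hg', continuous_iff_continuousAt]
    intro θ
    refine continuousAt_of_dominated (bound := fun x => ‖w₁ x‖) ?_ ?_ h₁.norm.integrableOn ?_
    · exact .of_forall fun θ => (h₁.indicator (hHm θ)).aestronglyMeasurable.restrict
    · exact .of_forall fun θ => .of_forall fun x => norm_indicator_le_norm_self _ _
    · have : ∀ᵐ x ∂μ, L θ x ≠ 0 := by rw [ae_iff]; simpa using hnull θ
      filter_upwards [ae_restrict_of_ae this] with x hx
      rcases lt_or_gt_of_ne hx with hx | hx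
      · refine continuousAt_const (y := (0 : ℝ)) |>.congr ?_
        filter_upwards [(hLθ x).continuousAt.eventually (gt_mem_nhds hx)] with θ' hθ'
        rw [indicator_of_notMem]
        simpa using hθ'
      · refine continuousAt_const (y := w₁ x) |>.congr ?_
        filter_upwards [(hLθ x).continuousAt.eventually (lt_mem_nhds hx)] with θ' hθ'
        rw [indicator_of_mem]
        exact le_of_lt hθ'
  have hsum : g 0 + g Real.pi = 0 := by
    have := hsplit w₁ h₁ 0
    rw [zero_add, hK.integral_eq] at this
    exact this
  obtain ⟨θ, hθ⟩ : ∃ θ, g θ = 0 := by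
    rcases le_total (g 0) 0 with h0 | h0
    · exact mem_range_of_exists_le_of_exists_ge hgc ⟨0, h0⟩ ⟨Real.pi, by linarith⟩
    · exact mem_range_of_exists_le_of_exists_ge hgc ⟨Real.pi, by linarith⟩ ⟨0, h0⟩
  have hθ' : g (θ + Real.pi) = 0 := by
    have := hsplit w₁ h₁ θ
    rw [hK.integral_eq] at this
    change g θ + g (θ + Real.pi) = 0 at this
    linarith
  have hcl : ∀ θ, IsClosed {x | 0 ≤ L θ x} := fun θ => isClosed_le continuous_const (hLx θ)
  have hcv : ∀ θ, Convex ℝ {x | 0 ≤ L θ x} := by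
    intro θ x (hx : 0 ≤ L θ x) y (hy : 0 ≤ L θ y) a b ha hb hab
    have : L θ (a • x + b • y) = a * L θ x + b * L θ y := by
      simp only [hL, PiLp.add_apply, PiLp.smul_apply, smul_eq_mul]
      have : b = 1 - a := by linarith
      subst this; ring
    change 0 ≤ L θ (a • x + b • y)
    rw [this]; positivity
  have main : ∀ θ, g θ = 0 → 0 < ∫ x in K ∩ {x | 0 ≤ L θ x}, w₂ x ∂μ →
      ∃ K' ⊆ K, IsNeedleBody μ w₁ w₂ K' ∧ ∃ c s : ℝ, c ^ 2 + s ^ 2 = 1 ∧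
        ∀ x ∈ K', 0 ≤ c * (x i - p) + s * (x j - q) := fun θ h0 hpos =>
    ⟨K ∩ {x | 0 ≤ L θ x}, inter_subset_left,
      ⟨hK.isCompact.inter_right (hcl θ), hK.convex.inter (hcv θ), h0, hpos⟩,
      Real.cos θ, Real.sin θ, hcs θ, fun x hx => hx.2⟩
  have h2 := hsplit w₂ h₂ θ
  have hpos := hK.integral_pos
  by_cases hc : 0 < ∫ x in K ∩ {x | 0 ≤ L θ x}, w₂ x ∂μ
  · exact main θ hθ hc
  · exact main _ hθ' (by linarith)

/-- A nondegenerate triangle has a rational interior point, and no closed half-plane bounded by a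
line through an interior point contains all three vertices: the three nonnegative values have a
positive combination equal to zero, so they vanish and the normal is orthogonal to two independent
sides. Rationality leaves only countably many cuts to perform. -/
lemma exists_rat_barycentric {a b x : ℝ × ℝ}
    (hD : (b.1 - a.1) * (x.2 - a.2) - (b.2 - a.2) * (x.1 - a.1) ≠ 0) :
    ∃ p q : ℚ, ∀ c s : ℝ, c ^ 2 + s ^ 2 = 1 →
      ¬ (0 ≤ c * (a.1 - p) + s * (a.2 - q) ∧ 0 ≤ c * (b.1 - p) + s * (b.2 - q) ∧
        0 ≤ c * (x.1 - p) + s * (x.2 - q)) := by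
  set D := (b.1 - a.1) * (x.2 - a.2) - (b.2 - a.2) * (x.1 - a.1) with hDdef
  set β : ℝ × ℝ → ℝ := fun z => ((z.1 - a.1) * (x.2 - a.2) - (z.2 - a.2) * (x.1 - a.1)) / D with hβ
  set γ : ℝ × ℝ → ℝ := fun z => ((b.1 - a.1) * (z.2 - a.2) - (b.2 - a.2) * (z.1 - a.1)) / D with hγ
  have hβc : Continuous β := by simp only [hβ]; fun_prop
  have hγc : Continuous γ := by simp only [hγ]; fun_prop
  set U := {z : ℝ × ℝ | 0 < β z} ∩ {z | 0 < γ z} ∩ {z | β z + γ z < 1}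
  have hU : IsOpen U := ((isOpen_lt continuous_const hβc).inter
    (isOpen_lt continuous_const hγc)).inter (isOpen_lt (hβc.add hγc) continuous_const)
  set m : ℝ × ℝ := ((a.1 + b.1 + x.1) / 3, (a.2 + b.2 + x.2) / 3)
  have hβm : β m = 1 / 3 := by
    simp only [hβ, m]; rw [div_eq_iff hD, hDdef]; ring
  have hγm : γ m = 1 / 3 := by
    simp only [hγ, m]; rw [div_eq_iff hD, hDdef]; ring
  have hmU : m ∈ U := by
    refine ⟨⟨?_, ?_⟩, ?_⟩
    · change 0 < β m; rw [hβm]; norm_num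
    · change 0 < γ m; rw [hγm]; norm_num
    · change β m + γ m < 1; rw [hβm, hγm]; norm_num
  obtain ⟨⟨p, q⟩, hpq⟩ := (Rat.denseRange_cast (𝕜 := ℝ)).prodMap
    (Rat.denseRange_cast (𝕜 := ℝ)) |>.exists_mem_open hU ⟨m, hmU⟩
  refine ⟨p, q, fun c s hcs ⟨h1, h2, h3⟩ => ?_⟩
  obtain ⟨⟨hb, hg⟩, hbg⟩ := hpq
  simp only [Prod.map_apply, mem_ofPred_eq] at hb hg hbg
  set B := β ((p : ℝ), (q : ℝ)) with hB
  set G := γ ((p : ℝ), (q : ℝ)) with hG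
  have e1 : (1 - B - G) * a.1 + B * b.1 + G * x.1 = p := by
    simp only [hB, hG, hβ, hγ]; field_simp; rw [hDdef]; ring
  have e2 : (1 - B - G) * a.2 + B * b.2 + G * x.2 = q := by
    simp only [hB, hG, hβ, hγ]; field_simp; rw [hDdef]; ring
  set ya := c * (a.1 - p) + s * (a.2 - q) with hya
  set yb := c * (b.1 - p) + s * (b.2 - q) with hyb
  set yx := c * (x.1 - p) + s * (x.2 - q) with hyx
  have hs0 : (1 - B - G) * ya + B * yb + G * yx = 0 := by
    have : (1 - B - G) * ya + B * yb + G * yx =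
        c * ((1 - B - G) * a.1 + B * b.1 + G * x.1 - p) +
          s * ((1 - B - G) * a.2 + B * b.2 + G * x.2 - q) := by
      simp only [hya, hyb, hyx]; ring
    rw [this, e1, e2]; ring
  have hA : 0 < 1 - B - G := by linarith
  have ma := mul_nonneg hA.le h1
  have mb := mul_nonneg hb.le h2
  have mx := mul_nonneg hg.le h3
  have za : ya = 0 := by
    have : (1 - B - G) * ya = 0 := by linarith
    simpa [hA.ne'] using this
  have zb : yb = 0 := by
    have : B * yb = 0 := by linarith
    simpa [hb.ne'] using this
  have zx : yx = 0 := by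
    have : G * yx = 0 := by linarith
    simpa [hg.ne'] using this
  have d1 : c * (b.1 - a.1) + s * (b.2 - a.2) = 0 := by
    have : c * (b.1 - a.1) + s * (b.2 - a.2) = yb - ya := by simp only [hya, hyb]; ring
    rw [this, za, zb, sub_zero]
  have d2 : c * (x.1 - a.1) + s * (x.2 - a.2) = 0 := by
    have : c * (x.1 - a.1) + s * (x.2 - a.2) = yx - ya := by simp only [hya, hyx]; ring
    rw [this, za, zx, sub_zero]
  have hc0 : c * D = 0 := by
    rw [hDdef]; linear_combination (x.2 - a.2) * d1 - (b.2 - a.2) * d2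
  have hs0 : s * D = 0 := by
    rw [hDdef]; linear_combination (b.1 - a.1) * d2 - (x.1 - a.1) * d1
  have hc : c = 0 := by simpa [hD] using hc0
  have hs : s = 0 := by simpa [hD] using hs0
  simp [hc, hs] at hcs


lemma dist_proj_le {E : Type*} [NormedAddCommGroup E] [InnerProductSpace ℝ E] (a b x : E) (t : ℝ) :
    dist x (a + (inner ℝ (b - a) (x - a) / ‖b - a‖ ^ 2) • (b - a)) ≤ dist x (a + t • (b - a)) := by
  set v := b - a
  set y := x - a with hy
  rcases eq_or_ne v 0 with hv | hv
  · simp [hv]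
  have hv' : ‖v‖ ^ 2 ≠ 0 := by simpa using hv
  have e : ∀ t : ℝ, dist x (a + t • v) ^ 2 = ‖y‖ ^ 2 - 2 * t * inner ℝ v y + t ^ 2 * ‖v‖ ^ 2 := by
    intro t
    rw [dist_eq_norm, ← sub_sub, ← hy, norm_sub_sq_real, inner_smul_right, norm_smul,
      real_inner_comm, mul_pow, Real.norm_eq_abs, sq_abs]
    ring
  refine (sq_le_sq₀ dist_nonneg dist_nonneg).1 ?_
  rw [e, e]
  have : 0 ≤ (t * ‖v‖ ^ 2 - inner ℝ v y) ^ 2 / ‖v‖ ^ 2 := by positivity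
  have e2 : (t * ‖v‖ ^ 2 - inner ℝ v y) ^ 2 / ‖v‖ ^ 2 =
      t ^ 2 * ‖v‖ ^ 2 - 2 * t * inner ℝ v y + (inner ℝ v y) ^ 2 / ‖v‖ ^ 2 := by
    field_simp; ring
  have e3 : ‖y‖ ^ 2 - 2 * (inner ℝ v y / ‖v‖ ^ 2) * inner ℝ v y +
      (inner ℝ v y / ‖v‖ ^ 2) ^ 2 * ‖v‖ ^ 2 = ‖y‖ ^ 2 - (inner ℝ v y) ^ 2 / ‖v‖ ^ 2 := by
    field_simp; ring
  rw [e3]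
  linarith

/-- Three points of a set without nondegenerate planar projections of triangles are collinear. -/
lemma exists_eq_add_smul {a b x : RSpace k} (hab : a = b → x = a)
    (hD : ∀ i j, (b i - a i) * (x j - a j) - (b j - a j) * (x i - a i) = 0) :
    ∃ t : ℝ, x = a + t • (b - a) := by
  by_cases h : a = b
  · exact ⟨0, by simp [hab h]⟩
  obtain ⟨i, hi⟩ : ∃ i, b i - a i ≠ 0 := by
    by_contra! hc
    exact h (by ext i; linarith [hc i])
  refine ⟨(x i - a i) / (b i - a i), ?_⟩
  ext j
  simp only [PiLp.add_apply, PiLp.smul_apply, PiLp.sub_apply, smul_eq_mul]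
  field_simp
  linarith [hD i j]

/-- Localization: there are arbitrarily thin convex bodies satisfying the bisection constraints. -/
theorem IsNeedleBody.exists_thin (hμ : μ ≪ volume) (h₁ : Integrable w₁ μ)
    (h₂ : Integrable w₂ μ) {V : Set (RSpace k)} (hV : IsNeedleBody μ w₁ w₂ V) {ε : ℝ}
    (hε : 0 < ε) :
    ∃ K ⊆ V, IsNeedleBody μ w₁ w₂ K ∧ ∃ a ∈ K, ∃ b ∈ K,
      (∀ y ∈ K, ∀ z ∈ K, dist y z ≤ dist a b) ∧
      ∀ x ∈ K, dist x (a + (inner ℝ (b - a) (x - a) / ‖b - a‖ ^ 2) • (b - a)) ≤ ε := by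
  -- The `n`-th cut passes through the flat `x i = p`, `x j = q` encoded by `n`, so every coordinate
  -- plane and every rational point is eventually served.
  have hstep : ∀ (n : ℕ) (K : {K // IsNeedleBody μ w₁ w₂ K}),
      ∃ K' : {K // IsNeedleBody μ w₁ w₂ K}, K'.1 ⊆ K.1 ∧ ∀ (i j : Fin k) (p q : ℚ),
        Encodable.decode (α := Fin k × Fin k × ℚ × ℚ) n = some (i, j, p, q) → i ≠ j →
        ∃ c s : ℝ, c ^ 2 + s ^ 2 = 1 ∧ ∀ x ∈ K'.1, 0 ≤ c * (x i - p) + s * (x j - q) := by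
    intro n K
    rcases hd : Encodable.decode (α := Fin k × Fin k × ℚ × ℚ) n with _ | ⟨i, j, p, q⟩
    · exact ⟨K, Subset.rfl, by simp⟩
    · by_cases hij : i = j
      · refine ⟨K, Subset.rfl, fun i' j' p' q' h hne => ?_⟩
        simp only [Option.some.injEq, Prod.mk.injEq] at h
        exact absurd (h.1 ▸ h.2.1 ▸ hij) hne
      · obtain ⟨K', hsub, hK', hcs⟩ := K.2.exists_halfSpace hμ h₁ h₂ hij p q
        refine ⟨⟨K', hK'⟩, hsub, fun i' j' p' q' h hne => ?_⟩
        simp only [Option.some.injEq, Prod.mk.injEq] at h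
        obtain ⟨rfl, rfl, rfl, rfl⟩ := h
        exact hcs
  choose next hnext hhalf using hstep
  set S : ℕ → {K // IsNeedleBody μ w₁ w₂ K} := fun n => Nat.rec ⟨V, hV⟩ next n with hS
  have hSs : ∀ n, S (n + 1) = next n (S n) := fun n => rfl
  have hanti : Antitone fun n => (S n).1 := antitone_nat_of_succ_le fun n => hnext n (S n)
  have hne : ∀ n, (S n).1.Nonempty := by
    intro n
    by_contra hc
    have := (S n).2.integral_pos
    rw [not_nonempty_iff_eq_empty.1 hc] at this
    simp at this
  have hdiam : ∀ n, ∃ a ∈ (S n).1, ∃ b ∈ (S n).1, ∀ y ∈ (S n).1, ∀ z ∈ (S n).1,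
      dist y z ≤ dist a b := by
    intro n
    obtain ⟨⟨a, b⟩, ⟨ha, hb⟩, hmax⟩ := ((S n).2.isCompact.prod (S n).2.isCompact).exists_isMaxOn
      ((hne n).prod (hne n)) (f := fun p : RSpace k × RSpace k => dist p.1 p.2)
      (by fun_prop)
    exact ⟨a, ha, b, hb, fun y hy z hz => isMaxOn_iff.1 hmax (y, z) (mk_mem_prod hy hz)⟩
  choose a ha b hb hab using hdiam
  by_contra! hcon
  have hx : ∀ n, ∃ x ∈ (S n).1,
      ε < dist x (a n + (inner ℝ (b n - a n) (x - a n) / ‖b n - a n‖ ^ 2) • (b n - a n)) :=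
    fun n => hcon (S n).1 (hanti (Nat.zero_le n)) (S n).2 (a n) (ha n) (b n) (hb n) (hab n)
  choose x hxS hxε using hx
  have hV0 : ∀ n, (S n).1 ⊆ V := fun n => hanti (Nat.zero_le n)
  have htriple : ∀ n, (a n, b n, x n) ∈ V ×ˢ V ×ˢ V := fun n =>
    ⟨hV0 n (ha n), hV0 n (hb n), hV0 n (hxS n)⟩
  have hVc := hV.isCompact.prod (hV.isCompact.prod hV.isCompact)
  clear_value S
  obtain ⟨⟨a', b', x'⟩, -, φ, hφ, hlim⟩ := hVc.tendsto_subseq htriple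
  have la : Filter.Tendsto (fun n => a (φ n)) Filter.atTop (nhds a') :=
    (continuous_fst.tendsto _).comp hlim
  have lb : Filter.Tendsto (fun n => b (φ n)) Filter.atTop (nhds b') :=
    ((continuous_fst.comp continuous_snd).tendsto _).comp hlim
  have lx : Filter.Tendsto (fun n => x (φ n)) Filter.atTop (nhds x') :=
    ((continuous_snd.comp continuous_snd).tendsto _).comp hlim
  have hmem : ∀ (u : ℕ → RSpace k) (u' : RSpace k), (∀ n, u n ∈ (S n).1) →
      Filter.Tendsto (fun n => u (φ n)) Filter.atTop (nhds u') → ∀ m, u' ∈ (S m).1 := by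
    intro u u' hu hlu m
    refine (S m).2.isCompact.isClosed.mem_of_tendsto hlu ?_
    filter_upwards [Filter.eventually_ge_atTop m] with n hn
    exact hanti (hn.trans (hφ.id_le n)) (hu _)
  have ha' := hmem a a' ha la
  have hb' := hmem b b' hb lb
  have hx' := hmem x x' hxS lx
  -- The limits lie in every `S m`. If `a' = b'`, the diameters tend to zero and `x' = a'`. If they
  -- were not collinear, some coordinate projection of the triangle would be nondegenerate, and the
  -- cut through a rational interior point would have removed a vertex.
  have hcol : ∃ t : ℝ, x' = a' + t • (b' - a') := by
    refine exists_eq_add_smul (fun heq => ?_) fun i j => ?_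
    · have h1 : ∀ n, dist x' a' ≤ dist (a (φ n)) (b (φ n)) := fun n =>
        hab _ _ (hx' _) _ (ha' _)
      have := ge_of_tendsto' (la.dist lb) h1
      rw [heq, dist_self] at this
      rw [heq]
      exact dist_le_zero.1 this
    · by_contra hD
      have hij : i ≠ j := by
        rintro rfl; exact hD (by ring)
      obtain ⟨p, q, hpq⟩ := exists_rat_barycentric (a := (a' i, a' j)) (b := (b' i, b' j))
        (x := (x' i, x' j)) hD
      obtain ⟨c, s, hcs, hK⟩ := hhalf (Encodable.encode (i, j, p, q))
        (S (Encodable.encode (i, j, p, q))) i j p q (Encodable.encodek _) hij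
      rw [← hSs] at hK
      exact hpq c s hcs ⟨hK _ (ha' _), hK _ (hb' _), hK _ (hx' _)⟩
  obtain ⟨t, ht⟩ := hcol
  have hl : Filter.Tendsto
      (fun n => dist (x (φ n)) (a (φ n) + t • (b (φ n) - a (φ n)))) Filter.atTop (nhds 0) := by
    have := lx.dist (la.add ((lb.sub la).const_smul t))
    rwa [← ht, dist_self] at this
  obtain ⟨n, hn⟩ := (hl.eventually (gt_mem_nhds hε)).exists
  exact absurd (hn.trans (hxε (φ n))) (not_lt.2 (dist_proj_le _ _ _ _))

end Localization

/-! ### The dilation inequality in dimension `k` -/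

lemma IsLogConcave.mul_const {E : Type*} [AddCommGroup E] [Module ℝ E] {h : E → ℝ≥0∞}
    (hh : IsLogConcave h) (c : ℝ≥0∞) : IsLogConcave fun x => h x * c := by
  intro x y a b ha hb hab
  rw [ENNReal.mul_rpow_of_nonneg _ _ ha.le, ENNReal.mul_rpow_of_nonneg _ _ hb.le,
    mul_mul_mul_comm, ← ENNReal.rpow_add_of_nonneg _ _ ha.le hb.le, hab, ENNReal.rpow_one]
  exact mul_le_mul_left (hh x y a b ha hb hab) c

/-- The distribution of a unit-norm linear functional under a log-concave density has a
log-concave density. -/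
theorem IsLogConcave.exists_marginal {k : ℕ} {g : RSpace k → ℝ≥0∞} (hg : IsLogConcave g)
    {u : RSpace k} (hu : ‖u‖ = 1) :
    ∃ ρ : ℝ → ℝ≥0∞, IsLogConcave ρ ∧ ∀ T : Set ℝ, MeasurableSet T →
      ∫⁻ x in {x | inner ℝ u x ∈ T}, g x = ∫⁻ t in T, ρ t := by
  obtain _ | m := k
  · have : u = 0 := Subsingleton.elim _ _
    simp [this] at hu
  obtain ⟨b, hb⟩ := Orthonormal.exists_orthonormalBasis_extension_of_card_eq (𝕜 := ℝ)
    (E := RSpace (m + 1)) (ι := Fin (m + 1)) (by simp) (v := fun _ => u) (s := {0})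
    (by
      rw [orthonormal_iff_ite]
      rintro ⟨i, hi⟩ ⟨j, hj⟩
      obtain rfl : i = 0 := hi
      obtain rfl : j = 0 := hj
      simp [hu])
  have hb0 : b 0 = u := hb 0 rfl
  set e : ℝ × (Fin m → ℝ) ≃ᵐ RSpace (m + 1) :=
    ((MeasurableEquiv.piFinSuccAbove (fun _ : Fin (m + 1) => ℝ) 0).symm.trans
      (MeasurableEquiv.toLp 2 (Fin (m + 1) → ℝ))).trans b.measurableEquiv.symm with he
  have hep : MeasurePreserving e volume volume :=
    ((b.measurePreserving_measurableEquiv.symm).comp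
      (PiLp.volume_preserving_toLp (Fin (m + 1)))).comp
      (volume_preserving_piFinSuccAbove (fun _ : Fin (m + 1) => ℝ) 0).symm
  have hev : ∀ t y, e (t, y) = b.repr.symm (WithLp.toLp 2 (Fin.cons t y)) := by
    intro t y
    simp [he, MeasurableEquiv.piFinSuccAbove, Fin.insertNthEquiv]
    rfl
  have hinner : ∀ p, inner ℝ u (e p) = p.1 := by
    rintro ⟨t, y⟩
    rw [hev, ← hb0, ← b.repr_apply_apply]
    simp
  have hge : IsLogConcave fun p => g (e p) := by
    refine hg.comp_affine e fun x y a c _ => ?_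
    obtain ⟨x1, x2⟩ := x
    obtain ⟨y1, y2⟩ := y
    rw [Prod.smul_mk, Prod.smul_mk, Prod.mk_add_mk, hev, hev, hev, ← map_smul, ← map_smul,
      ← map_add]
    congr 1
    ext i
    refine Fin.cases ?_ (fun j => ?_) i <;> simp
  refine ⟨fun t => ∫⁻ y, g (e (t, y)), IsLogConcave.lintegral_pi m hge, fun T hT => ?_⟩
  rw [← hep.setLIntegral_comp_preimage_emb e.measurableEmbedding]
  have hpre : e ⁻¹' {x | inner ℝ u x ∈ T} = T ×ˢ univ := by
    ext p
    simp only [mem_preimage, mem_ofPred_eq, hinner, mem_prod, mem_univ, and_true]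
  rw [hpre, Measure.volume_eq_prod, ← Measure.prod_restrict, Measure.restrict_univ, lintegral_prod]
  have : AEMeasurable (fun p => g (e p)) (volume : Measure (ℝ × (Fin m → ℝ))) :=
    hg.aemeasurable.comp_quasiMeasurePreserving hep.quasiMeasurePreserving
  rw [Measure.volume_eq_prod] at this
  rw [← Measure.restrict_univ (μ := (volume : Measure (Fin m → ℝ))), Measure.prod_restrict]
  exact this.restrict

/-- A function on `V` satisfying, on every segment, the sublevel set estimate that follows from a
Remez inequality of degree `d`. -/
def HasRemezDegree {k : ℕ} (V : Set (RSpace k)) (G : RSpace k → ℝ) (d : ℝ) : Prop :=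
  ∀ a u : RSpace k, ‖u‖ = 1 → ∀ s y : ℝ, a + s • u ∈ V → a + y • u ∈ V → ∀ α β : ℝ, 0 < α →
    0 < β → β ≤ G (a + s • u) →
      volume {t | t ∈ uIcc s y ∧ G (a + t • u) ≤ α} ≤
        ENNReal.ofReal (4 * (α / β) ^ (1 / d) * |y - s|)

/-- The dilation inequality on a thin convex body. -/
lemma HasRemezDegree.measure_le_of_thin {k : ℕ} {H : RSpace k → ℝ≥0∞} (hH : IsLogConcave H)
    {K : Set (RSpace k)} (hK : IsCompact K) (hKc : Convex ℝ K)
    (hK0 : volume.withDensity H K ≠ 0) (hKt : volume.withDensity H K ≠ ⊤)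
    {G : RSpace k → ℝ} (hG : ContinuousOn G K) {d : ℝ} (hR : HasRemezDegree K G d)
    {a b : RSpace k} (ha : a ∈ K) (hb : b ∈ K) (hab : a ≠ b)
    (hdiam : ∀ y ∈ K, ∀ z ∈ K, dist y z ≤ dist a b) {ε η : ℝ}
    (hthin : ∀ x ∈ K, dist x (a + (inner ℝ (b - a) (x - a) / ‖b - a‖ ^ 2) • (b - a)) ≤ ε)
    (hη : ∀ x ∈ K, ∀ y ∈ K, dist x y ≤ ε → |G x - G y| ≤ η)
    {α β : ℝ} (hα : 0 < α) (hβ : 0 < β) {B S : Set (RSpace k)} (hBK : B ⊆ K) (hSK : S ⊆ K)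
    (hB : ∀ x ∈ B, G x ≤ α - η) (hS : ∀ x ∈ S, β + η ≤ G x) :
    volume.withDensity H S / volume.withDensity H K ≤ ENNReal.ofReal (16 * Real.exp
      (-((volume.withDensity H B / volume.withDensity H K).toReal /
        (4 * (α / β) ^ (1 / d))) / 6)) := by
  set μ := volume.withDensity H with hμ
  set L := ‖b - a‖ with hL
  have hL0 : 0 < L := norm_pos_iff.2 (sub_ne_zero.2 hab.symm)
  set u := L⁻¹ • (b - a) with hu
  have hu1 : ‖u‖ = 1 := by
    rw [hu, norm_smul, norm_inv, Real.norm_of_nonneg hL0.le, ← hL, inv_mul_cancel₀ hL0.ne']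
  have hbu : a + L • u = b := by
    rw [hu, smul_smul, mul_inv_cancel₀ hL0.ne', one_smul]; abel
  obtain ⟨ρ, hρ, hρT⟩ := ((hH.indicator hKc).mul_const (μ K)⁻¹).exists_marginal hu1
  have hKm := hK.measurableSet
  have hTm : ∀ T : Set ℝ, MeasurableSet T → MeasurableSet {x : RSpace k | inner ℝ u x ∈ T} :=
    fun T hT => (by fun_prop : Measurable fun x : RSpace k => inner ℝ u x) hT
  have hlaw : ∀ T, MeasurableSet T →
      volume.withDensity ρ T = μ ({x | inner ℝ u x ∈ T} ∩ K) / μ K := by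
    intro T hT
    rw [withDensity_apply _ hT, ← hρT T hT, lintegral_mul_const' _ _ (ENNReal.inv_ne_top.2 hK0),
      setLIntegral_indicator hKm, hμ, withDensity_apply _ ((hTm T hT).inter hKm), inter_comm,
      div_eq_mul_inv]
  have hρ1 : ∫⁻ t, ρ t = 1 := by
    have := hlaw univ MeasurableSet.univ
    rw [withDensity_apply _ MeasurableSet.univ, Measure.restrict_univ] at this
    rw [this]
    simp [ENNReal.div_self hK0 hKt]
  set sa := inner ℝ u a with hsa
  -- As `a`, `b` realize the diameter, `‖x - b‖ ≤ ‖b - a‖` gives a nonnegative component along `b -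
  -- a`, and `‖x - a‖ ≤ ‖b - a‖` bounds it above: `K` projects into the segment `[a, b]`.
  have hrange : ∀ x ∈ K, inner ℝ u x - sa ∈ Icc 0 L := by
    intro x hx
    have e0 : inner ℝ u x - sa = L⁻¹ * inner ℝ (b - a) (x - a) := by
      rw [hsa, ← inner_sub_right, hu, real_inner_smul_left]
    have e1 : ‖x - b‖ ^ 2 = ‖x - a‖ ^ 2 - 2 * inner ℝ (b - a) (x - a) + L ^ 2 := by
      rw [show x - b = (x - a) - (b - a) by abel, norm_sub_sq_real, real_inner_comm]
    have h1 : ‖x - b‖ ≤ L := by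
      have := hdiam x hx b hb
      rwa [dist_eq_norm, dist_comm, dist_eq_norm] at this
    have h2 : ‖x - a‖ ≤ L := by
      have := hdiam x hx a ha
      rwa [dist_eq_norm, dist_comm, dist_eq_norm] at this
    have h3 := norm_nonneg (x - a)
    have h4 := norm_nonneg (x - b)
    rw [e0]
    refine ⟨mul_nonneg (inv_nonneg.2 hL0.le) ?_, ?_⟩
    · nlinarith
    · rw [inv_mul_le_iff₀ hL0]
      calc inner ℝ (b - a) (x - a) ≤ ‖b - a‖ * ‖x - a‖ := real_inner_le_norm _ _
        _ ≤ L * L := by gcongr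
  have hγ : ∀ s ∈ Icc (0 : ℝ) L, a + s • u ∈ K := by
    intro s hs
    have : a + s • u = (1 - s / L) • a + (s / L) • b := by
      rw [hu, smul_smul, ← div_eq_mul_inv]
      module
    rw [this]
    refine hKc ha hb ?_ (div_nonneg hs.1 hL0.le) (by ring)
    rw [sub_nonneg, div_le_one hL0]; exact hs.2
  have hclose : ∀ x ∈ K, |G x - G (a + (inner ℝ u x - sa) • u)| ≤ η := by
    intro x hx
    refine hη x hx _ (hγ _ (hrange x hx)) ?_
    convert hthin x hx using 3
    rw [hsa, ← inner_sub_right, hu, real_inner_smul_left, smul_smul]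
    congr 1
    field_simp
  set a₀ := a - sa • u with ha₀
  have ha₀s : ∀ s : ℝ, a₀ + s • u = a + (s - sa) • u := fun s => by rw [ha₀, sub_smul]; abel
  have hGc : ContinuousOn (fun s : ℝ => G (a₀ + s • u)) (Icc sa (sa + L)) := by
    refine hG.comp (by fun_prop) fun s hs => ?_
    rw [ha₀s]
    exact hγ _ ⟨by linarith [hs.1], by linarith [hs.2]⟩
  set B' := {s | s ∈ Icc sa (sa + L) ∧ G (a₀ + s • u) ≤ α} with hB'
  set S' := {s | s ∈ Icc sa (sa + L) ∧ β ≤ G (a₀ + s • u)} with hS'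
  have hB'm : MeasurableSet B' :=
    (hGc.preimage_isClosed_of_isClosed isClosed_Icc isClosed_Iic).measurableSet
  have hS'm : MeasurableSet S' :=
    (hGc.preimage_isClosed_of_isClosed isClosed_Icc isClosed_Ici).measurableSet
  have hmem : ∀ x ∈ K, inner ℝ u x ∈ Icc sa (sa + L) := fun x hx => by
    have := hrange x hx
    exact ⟨by linarith [this.1], by linarith [this.2]⟩
  have hBle : μ B / μ K ≤ volume.withDensity ρ B' := by
    rw [hlaw B' hB'm]
    gcongr
    intro x hx
    refine ⟨⟨hmem x (hBK hx), ?_⟩, hBK hx⟩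
    rw [ha₀s]
    linarith [(abs_le.1 (hclose x (hBK hx))).1, hB x hx]
  have hSle : μ S / μ K ≤ volume.withDensity ρ S' := by
    rw [hlaw S' hS'm]
    gcongr
    intro x hx
    refine ⟨⟨hmem x (hSK hx), ?_⟩, hSK hx⟩
    rw [ha₀s]
    linarith [(abs_le.1 (hclose x (hSK hx))).2, hS x hx]
  have hδ : 0 < 4 * (α / β) ^ (1 / d) := by positivity
  have hfin : volume.withDensity ρ B' ≠ ⊤ := by
    refine ((measure_mono (subset_univ _)).trans_lt ?_).ne
    rw [withDensity_apply _ MeasurableSet.univ, Measure.restrict_univ, hρ1]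
    exact ENNReal.one_lt_top
  refine hSle.trans ((hρ.measure_le_exp hρ1 hδ hB'm ?_).trans ?_)
  · rintro s ⟨hs, hsβ⟩ y
    -- `B'` lies in `[sa, sa + L]`, so clamping `y` to this interval loses nothing of `B'` and does
    -- not increase the distance to `s`.
    set y' := max sa (min y (sa + L)) with hy'
    have hsaL : sa ≤ sa + L := by linarith
    have hy'm : y' ∈ Icc sa (sa + L) := ⟨le_max_left _ _, max_le hsaL (min_le_right _ _)⟩
    have hK' : ∀ t ∈ Icc sa (sa + L), a₀ + t • u ∈ K := fun t ht => by
      rw [ha₀s]; exact hγ _ ⟨by linarith [ht.1], by linarith [ht.2]⟩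
    refine (measure_mono (t := {t | t ∈ uIcc s y' ∧ G (a₀ + t • u) ≤ α}) ?_).trans
      ((hR a₀ u hu1 s y' (hK' s hs) (hK' y' hy'm) α β hα hβ hsβ).trans ?_)
    · rintro t ⟨⟨ht, htα⟩, hty⟩
      refine ⟨?_, htα⟩
      rw [mem_uIcc] at hty ⊢
      rcases hty with ⟨h1, h2⟩ | ⟨h1, h2⟩
      · exact .inl ⟨h1, le_max_of_le_right (le_min h2 ht.2)⟩
      · exact .inr ⟨max_le ht.1 ((min_le_left _ _).trans h1), h2⟩
    · apply ENNReal.ofReal_le_ofReal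
      refine mul_le_mul_of_nonneg_left ?_ hδ.le
      rcases le_total y sa with h | h
      · have : y' = sa := by rw [hy', min_eq_left (by linarith), max_eq_left h]
        rw [this, abs_of_nonpos (by linarith [hs.1]), abs_of_nonpos (by linarith [hs.1])]
        linarith
      · rcases le_total y (sa + L) with h' | h'
        · rw [hy', min_eq_left h', max_eq_right h]
        · have : y' = sa + L := by rw [hy', min_eq_right h', max_eq_right hsaL]
          rw [this, abs_of_nonneg (by linarith [hs.2]), abs_of_nonneg (by linarith [hs.2])]
          linarith
  · apply ENNReal.ofReal_le_ofReal
    have := ENNReal.toReal_mono hfin hBle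
    gcongr

lemma HasRemezDegree.mono {k : ℕ} {V K : Set (RSpace k)} {G : RSpace k → ℝ} {d : ℝ}
    (h : HasRemezDegree V G d) (hKV : K ⊆ V) : HasRemezDegree K G d :=
  fun a u hu s y hs hy => h a u hu s y (hKV hs) (hKV hy)

/-- Dimension-free dilation inequality for functions satisfying a Remez inequality. -/
theorem HasRemezDegree.measure_le {k : ℕ} {H : RSpace k → ℝ≥0∞} (hH : IsLogConcave H)
    {V : Set (RSpace k)} (hV : IsCompact V) (hVc : Convex ℝ V)
    [IsProbabilityMeasure (volume.withDensity H)] (hV1 : volume.withDensity H V = 1)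
    {G : RSpace k → ℝ} (hG : ContinuousOn G V) {d : ℝ} (hd : 0 < d) (hR : HasRemezDegree V G d)
    {α β : ℝ} (hα : 0 < α) (hβ : 0 < β) :
    volume.withDensity H {x | x ∈ V ∧ β ≤ G x} ≤ ENNReal.ofReal (16 * Real.exp
      (-((volume.withDensity H {x | x ∈ V ∧ G x ≤ α}).toReal * (β / α) ^ (1 / d) / 96))) := by
  set μ := volume.withDensity H with hμ
  set B := {x | x ∈ V ∧ G x ≤ α} with hB
  set S := {x | x ∈ V ∧ β ≤ G x} with hS
  have hBm : MeasurableSet B :=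
    (hG.preimage_isClosed_of_isClosed hV.isClosed isClosed_Iic).measurableSet
  have hSm : MeasurableSet S :=
    (hG.preimage_isClosed_of_isClosed hV.isClosed isClosed_Ici).measurableSet
  set v := (μ B).toReal with hv
  set T := (β / α) ^ (1 / d) with hT
  have hT0 : 0 < T := by positivity
  have hv0 : 0 ≤ v := ENNReal.toReal_nonneg
  have hv1 : v ≤ 1 := by
    have := ENNReal.toReal_mono ENNReal.one_ne_top (prob_le_one (μ := μ) (s := B))
    simpa using this
  set p := 16 * Real.exp (-(v * T / 96)) with hp
  have hp0 : 0 < p := by positivity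
  by_contra! hcon
  have hp1 : p < 1 := by
    have := hcon.trans_le prob_le_one
    rwa [ENNReal.ofReal_lt_one] at this
  -- Since `16 / e > 1`, the bound is below `1` only if `v * T > 96`; hence only `v > 0` and `α < β`
  -- matter.
  have hbig : 96 < v * T := by
    by_contra! hc
    have : -1 ≤ -(v * T / 96) := by linarith
    have h1 := Real.exp_le_exp.2 this
    have h2 : Real.exp (-1) ≥ 1 / 16 := by
      rw [Real.exp_neg, ge_iff_le, one_div]
      exact inv_anti₀ (Real.exp_pos 1) (by linarith [Real.exp_one_lt_d9])
    linarith
  have hvpos : 0 < v := by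
    by_contra! hc
    have : v = 0 := le_antisymm hc hv0
    rw [this] at hbig; linarith
  have hTbig : 96 < T := by nlinarith
  -- Moving the thresholds leaves room for the oscillation `η` of `G` on fibres. It multiplies
  -- `(α/β)^(1/d)` by `4`, so `δ = 16 / T`, and `96 = 16 * 6`.
  set α' := 2 ^ d * α with hα'
  set β' := β / 2 ^ d with hβ'
  have h2d : (1 : ℝ) < 2 ^ d := Real.one_lt_rpow (by norm_num) hd
  have hα'0 : 0 < α' := by positivity
  have hβ'0 : 0 < β' := by positivity
  have hαα' : α < α' := by nlinarith
  have hββ' : β' < β := div_lt_self hβ h2d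
  have hratio : 4 * (α' / β') ^ (1 / d) = 16 / T := by
    have e : α' / β' = (4 : ℝ) ^ d * (β / α)⁻¹ := by
      rw [hα', hβ', show (4 : ℝ) = 2 * 2 by norm_num, Real.mul_rpow (by norm_num) (by norm_num)]
      field_simp
    rw [e, Real.mul_rpow (by positivity) (by positivity), ← Real.rpow_mul (by norm_num),
      mul_one_div_cancel hd.ne', Real.rpow_one, Real.inv_rpow (by positivity), ← hT]
    field_simp; norm_num
  have hαβ : α < β := by
    by_contra! hc
    have : T ≤ 1 := Real.rpow_le_one (by positivity) ((div_le_one hα).2 hc) (by positivity)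
    linarith
  set η := min (α' - α) (β - β') with hη
  have hη0 : 0 < η := lt_min (by linarith) (by linarith)
  obtain ⟨ε, hε, hGε⟩ := Metric.uniformContinuousOn_iff_le.1
    (hV.uniformContinuousOn_of_continuous hG) η hη0
  -- The vanishing integral of `w₁` fixes the proportion of `B` at `v`; the positive integral of
  -- `w₂` keeps that of `S` above `p`.
  set w₁ : RSpace k → ℝ := fun x => B.indicator (fun _ => (1 : ℝ)) x - v with hw₁
  set w₂ : RSpace k → ℝ := fun x => S.indicator (fun _ => (1 : ℝ)) x - p with hw₂
  have h₁ : Integrable w₁ μ :=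
    ((integrable_const _).indicator hBm).sub (integrable_const _)
  have h₂ : Integrable w₂ μ :=
    ((integrable_const _).indicator hSm).sub (integrable_const _)
  have hint : ∀ (A K : Set (RSpace k)) (c : ℝ), MeasurableSet A →
      ∫ x in K, (A.indicator (fun _ => (1 : ℝ)) x - c) ∂μ =
        (μ (A ∩ K)).toReal - c * (μ K).toReal := by
    intro A K c hA
    rw [integral_sub ((integrable_const _).indicator hA) (integrable_const _),
      integral_indicator_const _ hA, integral_const]
    simp [Measure.real, hA, mul_comm]
  have hVb : IsNeedleBody μ w₁ w₂ V := by
    refine ⟨hV, hVc, ?_, ?_⟩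
    · rw [hint B V v hBm, inter_eq_self_of_subset_left (fun x hx => hx.1), hV1]
      simp [hv]
    · rw [hint S V p hSm, inter_eq_self_of_subset_left (fun x hx => hx.1), hV1]
      have := (ENNReal.ofReal_lt_iff_lt_toReal hp0.le (measure_ne_top μ S)).1 hcon
      simp only [ENNReal.toReal_one, mul_one]
      linarith
  obtain ⟨K, hKV, hK, a, ha, b, hb, hdiam, hthin⟩ :=
    hVb.exists_thin (withDensity_absolutelyContinuous _ _) h₁ h₂ hε
  have e₁ := hK.integral_eq
  have e₂ := hK.integral_pos
  rw [hint B K v hBm] at e₁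
  rw [hint S K p hSm] at e₂
  have hSK : 0 < (μ (S ∩ K)).toReal := by
    have := mul_nonneg hp0.le (ENNReal.toReal_nonneg (a := μ K))
    linarith
  have hKpos : 0 < (μ K).toReal :=
    hSK.trans_le (ENNReal.toReal_mono (measure_ne_top _ _) (measure_mono inter_subset_right))
  have hBK : 0 < (μ (B ∩ K)).toReal := by
    have := mul_pos hvpos hKpos
    linarith
  have hne : ∀ A : Set (RSpace k), 0 < (μ A).toReal → A.Nonempty := fun A hA =>
    nonempty_of_measure_ne_zero (μ := μ) fun h => by simp [h] at hA
  obtain ⟨x, ⟨-, hxS⟩, hxK⟩ := hne _ hSK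
  obtain ⟨y, ⟨-, hyB⟩, hyK⟩ := hne _ hBK
  have hab : a ≠ b := by
    intro hab
    have := hdiam x hxK y hyK
    rw [hab, dist_self, dist_le_zero] at this
    rw [this] at hxS
    linarith
  have key := (hR.mono hKV).measure_le_of_thin hH hK.isCompact hK.convex
    (by intro h; rw [← hμ] at h; simp [h] at hKpos) (measure_ne_top _ _) (hG.mono hKV) ha hb hab
    hdiam hthin (fun x hx y hy hxy => hGε x (hKV hx) y (hKV hy) hxy) hα'0 hβ'0
    (B := B ∩ K) (S := S ∩ K) inter_subset_right inter_subset_right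
    (fun x hx => by linarith [hx.1.2, min_le_left (α' - α) (β - β')])
    (fun x hx => by linarith [hx.1.2, min_le_right (α' - α) (β - β')])
  have ev : (μ (B ∩ K) / μ K).toReal = v := by
    rw [ENNReal.toReal_div, div_eq_iff hKpos.ne']; linarith
  rw [← hμ, hratio, ev] at key
  have e3 : -(v / (16 / T)) / 6 = -(v * T / 96) := by field_simp; norm_num
  rw [e3, ← hp] at key
  have := ENNReal.toReal_le_of_le_ofReal hp0.le key
  rw [ENNReal.toReal_div, div_le_iff₀ hKpos] at this
  linarith

/-! ### From the median to the geometric mean -/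

lemma exists_median {Ω : Type*} [MeasurableSpace Ω] {μ : Measure Ω} [IsProbabilityMeasure μ]
    {g : Ω → ℝ} (hg : Measurable g) (hg0 : ∀ x, 0 ≤ g x) :
    ∃ m : ℝ, 0 ≤ m ∧ 1 / 2 ≤ μ {x | g x ≤ m} ∧ 1 / 2 ≤ μ {x | m ≤ g x} := by
  set A := {t : ℝ | 1 / 2 ≤ μ {x | g x ≤ t}} with hA
  have hle : ∀ t, MeasurableSet {x | g x ≤ t} := fun t => measurableSet_le hg measurable_const
  have hbdd : ∀ t ∈ A, 0 ≤ t := by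
    intro t ht
    by_contra! hc
    have h0 : {x | g x ≤ t} = ∅ := by
      ext x; simpa using hc.trans_le (hg0 x)
    have ht : 1 / 2 ≤ μ {x | g x ≤ t} := ht
    rw [h0] at ht
    simp at ht
  have hne : A.Nonempty := by
    have hmono : Monotone fun n : ℕ => {x | g x ≤ n} := fun m n hmn x (hx : g x ≤ m) =>
      hx.trans (by exact_mod_cast hmn)
    have hlim := tendsto_measure_iUnion_atTop (μ := μ) hmono
    have hU : ⋃ n : ℕ, {x | g x ≤ n} = univ := by
      ext x; simpa using exists_nat_ge (g x)
    rw [hU, measure_univ] at hlim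
    obtain ⟨n, hn⟩ := (hlim.eventually (lt_mem_nhds (a := 1 / 2)
      (ENNReal.half_lt_self one_ne_zero ENNReal.one_ne_top))).exists
    exact ⟨n, le_of_lt hn⟩
  set m := sInf A with hm
  have hm0 : 0 ≤ m := le_csInf hne hbdd
  refine ⟨m, hm0, ?_, ?_⟩
  · have hanti : Antitone fun n : ℕ => {x | g x ≤ m + 1 / (n + 1)} :=
      fun i j hij x (hx : g x ≤ _) => hx.trans (by gcongr)
    have hlim := tendsto_measure_iInter_atTop (μ := μ) (fun n => (hle _).nullMeasurableSet) hanti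
      ⟨0, measure_ne_top _ _⟩
    have hI : ⋂ n : ℕ, {x | g x ≤ m + 1 / (n + 1)} = {x | g x ≤ m} := by
      ext x
      simp only [mem_iInter, mem_ofPred_eq]
      refine ⟨fun h => ?_, fun h n => h.trans (by simp; positivity)⟩
      refine le_of_forall_pos_le_add fun ε hε => ?_
      obtain ⟨n, hn⟩ := exists_nat_one_div_lt hε
      exact (h n).trans (by linarith)
    rw [hI] at hlim
    refine ge_of_tendsto' hlim fun n => ?_
    have hpos : (0 : ℝ) < 1 / (n + 1) := by positivity
    obtain ⟨t, ht, htm⟩ := exists_lt_of_csInf_lt hne (show sInf A < m + 1 / (n + 1) by linarith)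
    have ht : 1 / 2 ≤ μ {x | g x ≤ t} := ht
    exact ht.trans (measure_mono fun x (hx : g x ≤ t) => hx.trans htm.le)
  · have hanti : Antitone fun n : ℕ => {x | m - 1 / (n + 1) < g x} :=
      fun i j hij x (hx : _ < g x) => lt_of_le_of_lt (by gcongr) hx
    have hlim := tendsto_measure_iInter_atTop (μ := μ)
      (fun n => (measurableSet_lt measurable_const hg).nullMeasurableSet) hanti
      ⟨0, measure_ne_top _ _⟩
    have hI : ⋂ n : ℕ, {x | m - 1 / (n + 1) < g x} = {x | m ≤ g x} := by
      ext x
      simp only [mem_iInter, mem_ofPred_eq]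
      refine ⟨fun h => ?_, fun h n => lt_of_lt_of_le (by simp; positivity) h⟩
      refine le_of_forall_pos_le_add fun ε hε => ?_
      obtain ⟨n, hn⟩ := exists_nat_one_div_lt hε
      linarith [h n]
    rw [hI] at hlim
    refine ge_of_tendsto' hlim fun n => ?_
    have hpos : (0 : ℝ) < 1 / (n + 1) := by positivity
    have hnot : m - 1 / (n + 1) ∉ A := fun h => by
      have := csInf_le ⟨0, hbdd⟩ h
      linarith
    have hlt : μ {x | g x ≤ m - 1 / (n + 1)} < 1 / 2 := not_le.1 hnot
    have hc : {x | m - 1 / ((n : ℝ) + 1) < g x} = {x | g x ≤ m - 1 / (n + 1)}ᶜ := by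
      ext x; simp
    rw [Function.comp_apply, hc, prob_compl_eq_one_sub (hle _)]
    refine ENNReal.le_sub_of_add_le_left (ne_top_of_lt hlt) ?_
    calc _ ≤ (1 / 2 : ℝ≥0∞) + 1 / 2 := by gcongr
      _ = 1 := ENNReal.add_halves 1

lemma integrable_of_exp_tail {Ω : Type*} [MeasurableSpace Ω] {μ : Measure Ω} {X : Ω → ℝ}
    (hX : Measurable X) {A : ℝ} (hA : 0 ≤ A)
    (h : ∀ s, 0 < s → μ {x | s ≤ |X x|} ≤ ENNReal.ofReal (A * Real.exp (-s))) :
    Integrable X μ ∧ |∫ x, X x ∂μ| ≤ A := by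
  have hl : ∫⁻ x, ENNReal.ofReal |X x| ∂μ ≤ ENNReal.ofReal A := by
    rw [lintegral_eq_lintegral_meas_le μ (f := fun x => |X x|)
      (Filter.Eventually.of_forall fun x => abs_nonneg _) (by fun_prop)]
    refine (setLIntegral_mono' measurableSet_Ioi fun s hs => h s hs).trans ?_
    rw [← ofReal_integral_eq_lintegral_ofReal ((integrableOn_exp_neg_Ioi 0).const_mul A)
      (.of_forall fun s => by positivity), integral_const_mul, integral_exp_neg_Ioi_zero, mul_one]
  have hi : Integrable X μ := by
    refine ⟨hX.aestronglyMeasurable, ?_⟩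
    rw [hasFiniteIntegral_iff_norm]
    exact hl.trans_lt ENNReal.ofReal_lt_top
  refine ⟨hi, ?_⟩
  calc |∫ x, X x ∂μ| ≤ ∫ x, |X x| ∂μ := abs_integral_le_integral_abs
    _ ≤ A := by
      rw [integral_eq_lintegral_of_nonneg_ae (.of_forall fun x => abs_nonneg _)
        hi.abs.aestronglyMeasurable]
      exact ENNReal.toReal_le_of_le_ofReal hA hl

/-- From the dilation inequality to deviations from the geometric mean. -/
theorem deviation_of_dilation {Ω : Type*} [MeasurableSpace Ω] {μ : Measure Ω}
    [IsProbabilityMeasure μ] {g : Ω → ℝ} (hg : Measurable g) (hg0 : ∀ x, 0 ≤ g x) {d : ℝ}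
    (hd : 0 < d)
    (hD : ∀ α β : ℝ, 0 < α → 0 < β → μ {x | β ≤ g x} ≤ ENNReal.ofReal (16 * Real.exp
      (-((μ {x | g x ≤ α}).toReal * (β / α) ^ (1 / d) / 96))))
    (hpos : ∃ β : ℝ, 0 < β ∧ μ {x | β ≤ g x} ≠ 0) :
    μ {x | g x ≤ 0} = 0 ∧ Integrable (fun x => Real.log (g x)) μ ∧ ∀ α : ℝ, 0 < α →
      μ {x | α * Real.exp (∫ x, Real.log (g x) ∂μ) ≤ g x} ≤
        ENNReal.ofReal (16 * Real.exp (-(Real.exp (-3500) / 192) * α ^ (1 / d))) ∧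
      μ {x | g x ≤ α * Real.exp (∫ x, Real.log (g x) ∂μ)} ≤
        ENNReal.ofReal (400 * Real.exp 3500 * α ^ (1 / d)) := by
  have hzero : μ {x | g x ≤ 0} = 0 := by
    obtain ⟨β, hβ, hq⟩ := hpos
    by_contra hv
    set q := (μ {x | β ≤ g x}).toReal
    set v := (μ {x | g x ≤ 0}).toReal
    have hq0 : 0 < q := ENNReal.toReal_pos hq (measure_ne_top _ _)
    have hv0 : 0 < v := ENNReal.toReal_pos hv (measure_ne_top _ _)
    have hq1 : q ≤ 1 := by
      simpa using ENNReal.toReal_mono ENNReal.one_ne_top (prob_le_one (μ := μ) (s := {x | β ≤ g x}))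
    have hlog : 0 ≤ Real.log (16 / q) := Real.log_nonneg (by rw [le_div_iff₀ hq0]; linarith)
    -- Chosen so that `16 exp(-v T / 96)` is less than `q`: positive mass at zero contradicts the
    -- dilation inequality as the lower threshold decreases to `0`.
    set T := (96 * Real.log (16 / q) + 1) / v with hT
    have hT0 : 0 < T := by positivity
    have hTd : 0 < T ^ d := by positivity
    have h1 := hD (β / T ^ d) β (by positivity) hβ
    rw [div_div_cancel₀ hβ.ne', ← Real.rpow_mul hT0.le, mul_one_div_cancel hd.ne',
      Real.rpow_one] at h1
    have h2 : q ≤ 16 * Real.exp (-(v * T / 96)) := by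
      refine (ENNReal.toReal_le_of_le_ofReal (by positivity) h1).trans ?_
      have : v ≤ (μ {x | g x ≤ β / T ^ d}).toReal :=
        ENNReal.toReal_mono (measure_ne_top _ _)
          (measure_mono fun x (hx : g x ≤ 0) => hx.trans (by positivity))
      gcongr
    have h3 : v * T = 96 * Real.log (16 / q) + 1 := by rw [hT]; field_simp
    have h4 := Real.log_le_log hq0 h2
    rw [Real.log_mul (by norm_num) (Real.exp_pos _).ne', Real.log_exp, h3,
      Real.log_div (by norm_num) hq0.ne'] at h4
    linarith
  obtain ⟨m, hm0, hm1, hm2⟩ := exists_median (μ := μ) hg hg0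
  have hm : 0 < m := by
    refine lt_of_le_of_ne hm0 fun h => ?_
    rw [← h, hzero] at hm1
    simp at hm1
  have half : ((1 / 2 : ℝ≥0∞)).toReal = 1 / 2 := by simp
  have hm1' : 1 / 2 ≤ (μ {x | g x ≤ m}).toReal := by
    rw [← half]; exact ENNReal.toReal_mono (measure_ne_top _ _) hm1
  have hm2' : 1 / 2 ≤ (μ {x | m ≤ g x}).toReal := by
    rw [← half]; exact ENNReal.toReal_mono (measure_ne_top _ _) hm2
  have hup : ∀ β, 0 < β → μ {x | β ≤ g x} ≤
      ENNReal.ofReal (16 * Real.exp (-((β / m) ^ (1 / d) / 192))) := by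
    intro β hβ
    refine (hD m β hm hβ).trans (ENNReal.ofReal_le_ofReal ?_)
    have : 0 < (β / m) ^ (1 / d) := by positivity
    have h5 : (β / m) ^ (1 / d) / 192 ≤
        (μ {x | g x ≤ m}).toReal * (β / m) ^ (1 / d) / 96 := by nlinarith
    gcongr
  -- With upper threshold `m` the left side is at least `1/2`, so `μ{g ≤ α} (m/α)^(1/d) ≤ 96 log 32
  -- < 400`.
  have hlow : ∀ α, 0 < α → μ {x | g x ≤ α} ≤ ENNReal.ofReal (400 * (α / m) ^ (1 / d)) := by
    intro α hα
    have h1 := ENNReal.toReal_le_of_le_ofReal (by positivity) (hD α m hα hm)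
    have h2 := Real.log_le_log (by norm_num) (hm2'.trans h1)
    rw [Real.log_mul (by norm_num) (Real.exp_pos _).ne', Real.log_exp,
      show (16 : ℝ) = 2 ^ 4 by norm_num, Real.log_pow, Real.log_div (by norm_num) (by norm_num),
      Real.log_one] at h2
    have := Real.log_two_lt_d9
    have h3 : (μ {x | g x ≤ α}).toReal * (m / α) ^ (1 / d) ≤ 400 := by
      push_cast at h2; linarith
    have h4 : (α / m) ^ (1 / d) = ((m / α) ^ (1 / d))⁻¹ := by
      rw [← Real.inv_rpow (by positivity), inv_div]
    rw [← ENNReal.ofReal_toReal (measure_ne_top μ {x | g x ≤ α})]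
    apply ENNReal.ofReal_le_ofReal
    rw [h4, ← div_eq_mul_inv, le_div_iff₀ (by positivity)]
    exact h3
  have hgpos : ∀ᵐ x ∂μ, 0 < g x := by
    rw [ae_iff]; simpa using hzero
  set X : Ω → ℝ := fun x => Real.log (g x / m) / d with hX
  have hXm : Measurable X := by fun_prop
  have hpow : ∀ s : ℝ, (m * Real.exp (d * s) / m) ^ (1 / d) = Real.exp s := by
    intro s
    rw [mul_div_cancel_left₀ _ hm.ne', ← Real.exp_mul]
    congr 1; field_simp
  -- The upper tail is at most `16 exp(-exp s / 192) ≤ 16 * 192 exp(-s)`, the lower one at most `400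
  -- exp(-s)`; the coefficients sum to `3472`.
  obtain ⟨hXi, hXE⟩ := integrable_of_exp_tail (μ := μ) hXm (A := 3500) (by norm_num) (by
    intro s hs
    have hsub : ∀ᵐ x ∂μ, x ∈ {x | s ≤ |X x|} →
        x ∈ {x | m * Real.exp (d * s) ≤ g x} ∪ {x | g x ≤ m * Real.exp (d * -s)} := by
      filter_upwards [hgpos] with x hx hxs
      have hxs : s ≤ |X x| := hxs
      rcases le_abs.1 hxs with h | h
      · left
        rw [hX, le_div_iff₀ hd, Real.le_log_iff_exp_le (by positivity), le_div_iff₀ hm] at h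
        change m * Real.exp (d * s) ≤ g x
        rw [mul_comm d s]; linarith
      · right
        have h : X x ≤ -s := by linarith
        rw [hX, div_le_iff₀ hd, Real.log_le_iff_le_exp (by positivity), div_le_iff₀ hm] at h
        change g x ≤ m * Real.exp (d * -s)
        rw [mul_comm d (-s)]; linarith
    refine (measure_mono_ae hsub).trans ((measure_union_le _ _).trans
      ((add_le_add (hup _ (by positivity)) (hlow _ (by positivity))).trans ?_))
    rw [hpow, hpow, ← ENNReal.ofReal_add (by positivity) (by positivity)]
    apply ENNReal.ofReal_le_ofReal
    have h1 : Real.exp (-(Real.exp s / 192)) ≤ 192 * Real.exp (-s) := by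
      rw [Real.exp_neg, Real.exp_neg, ← div_eq_mul_inv, inv_le_comm₀ (by positivity) (by positivity),
        inv_div]
      linarith [Real.add_one_le_exp (Real.exp s / 192)]
    have := Real.exp_pos (-s)
    linarith)
  set E := ∫ x, X x ∂μ with hE
  have hlogae : (fun x => Real.log (g x)) =ᵐ[μ] fun x => d * X x + Real.log m := by
    filter_upwards [hgpos] with x hx
    simp only [hX]
    rw [mul_div_cancel₀ _ hd.ne', Real.log_div hx.ne' hm.ne']
    ring
  have hint : Integrable (fun x => Real.log (g x)) μ :=
    ((hXi.const_mul d).add (integrable_const _)).congr hlogae.symm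
  have hM : Real.exp (∫ x, Real.log (g x) ∂μ) = m * Real.exp (d * E) := by
    rw [integral_congr_ae hlogae, integral_add (hXi.const_mul d) (integrable_const _),
      integral_const_mul, integral_const]
    simp only [probReal_univ, one_smul]
    rw [Real.exp_add, Real.exp_log hm, mul_comm]
  have hE' := abs_le.1 hXE
  have hpow2 : ∀ α : ℝ, 0 < α → (α * (m * Real.exp (d * E)) / m) ^ (1 / d) =
      α ^ (1 / d) * Real.exp E := by
    intro α hα
    rw [mul_div_assoc, Real.mul_rpow hα.le (by positivity), hpow]
  refine ⟨hzero, hint, fun α hα => ⟨?_, ?_⟩⟩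
  · rw [hM]
    refine (hup _ (by positivity)).trans (ENNReal.ofReal_le_ofReal ?_)
    rw [hpow2 α hα]
    have h1 : Real.exp (-3500) ≤ Real.exp E := Real.exp_le_exp.2 hE'.1
    have h2 : 0 < α ^ (1 / d) := by positivity
    have h3 : α ^ (1 / d) * Real.exp (-3500) ≤ α ^ (1 / d) * Real.exp E := by gcongr
    gcongr
    linarith
  · rw [hM]
    refine (hlow _ (by positivity)).trans (ENNReal.ofReal_le_ofReal ?_)
    rw [hpow2 α hα]
    have h1 : Real.exp E ≤ Real.exp 3500 := Real.exp_le_exp.2 hE'.2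
    have h2 : 0 < α ^ (1 / d) := by positivity
    have h3 : α ^ (1 / d) * Real.exp E ≤ α ^ (1 / d) * Real.exp 3500 := by gcongr
    linarith

/-! ### From the Chebyshev degree to the theorem -/

lemma LogConcave.isLogConcave {k : ℕ} {h : RSpace k → ℝ} (hh : LogConcave h) :
    IsLogConcave fun x => ENNReal.ofReal (h x) := by
  intro x y a b ha hb hab
  rcases (hh.1 x).eq_or_lt with hx | hx
  · simp [← hx, ENNReal.zero_rpow_of_pos ha]
  rcases (hh.1 y).eq_or_lt with hy | hy
  · simp [← hy, ENNReal.zero_rpow_of_pos hb]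
  have hz : 0 < h (a • x + b • y) := hh.2.1 hx hy ha.le hb.le hab
  have key := hh.2.2 hx hy ha.le hb.le hab
  simp only [smul_eq_mul] at key
  rw [ENNReal.ofReal_rpow_of_pos hx, ENNReal.ofReal_rpow_of_pos hy,
    ← ENNReal.ofReal_mul (by positivity)]
  apply ENNReal.ofReal_le_ofReal
  rw [← Real.log_le_log_iff (by positivity) hz, Real.log_mul (by positivity) (by positivity),
    Real.log_rpow hx, Real.log_rpow hy]
  exact key

/-- The infimum defining the Chebyshev degree is attained. -/
lemma remezBound_chebyshevDegree {n : ℕ} {f : CSpace n → ℂ} (hd : 0 < chebyshevDegree f) :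
    RemezBound f (chebyshevDegree f) := by
  set A := {d : ℝ | 0 < d ∧ RemezBound f d} with hA
  have hne : A.Nonempty := by
    -- An empty set of exponents has real infimum `0`, which the positivity of the degree excludes.
    by_contra hc
    have : chebyshevDegree f = sInf A := rfl
    rw [this, not_nonempty_iff_eq_empty.1 hc, Real.sInf_empty] at hd
    exact lt_irrefl _ hd
  have hcl : chebyshevDegree f ∈ closure A := csInf_mem_closure hne ⟨0, fun d hd => hd.1.le⟩
  intro a b hab ω hω hωm hω0
  have hbase : 4 * dist a b / (μH[1] ω).toReal ≠ 0 := by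
    have h1 : μH[1] ω ≤ μH[1] (segment ℝ a b) := measure_mono hω
    rw [hausdorffMeasure_segment, edist_dist] at h1
    have h2 : 0 < dist a b := ENNReal.ofReal_pos.1 (hω0.trans_le h1)
    have h3 : 0 < (μH[1] ω).toReal :=
      ENNReal.toReal_pos hω0.ne' (ne_top_of_le_ne_top ENNReal.ofReal_ne_top h1)
    positivity
  have hclosed : IsClosed {d : ℝ | sSup ((fun z => ‖f z‖) '' segment ℝ a b) ≤
      (4 * dist a b / (μH[1] ω).toReal) ^ d * sSup ((fun z => ‖f z‖) '' ω)} := by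
    refine isClosed_le continuous_const ?_
    exact (Real.continuous_const_rpow hbase).mul continuous_const
  exact closure_minimal (fun d hd => hd.2 a b hab ω hω hωm hω0) hclosed hcl

/-- The Remez inequality is applied to the sublevel set `ω` itself: the supremum over the segment is
at least `β` and that over `ω` at most `α`, so `β/α ≤ (4|I|/|ω|)^d`, which is solved for `|ω|`. -/
lemma RemezBound.hasRemezDegree {n k : ℕ} {f : CSpace n → ℂ} (hf : ContinuousOn f (ball 0 1))
    {d : ℝ} (hd : 0 < d) (hR : RemezBound f d) (φ : RSpace k →ᵃⁱ[ℝ] CSpace n)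
    {V : Set (RSpace k)} (hV : Convex ℝ V) (hφV : ∀ x ∈ V, φ x ∈ ball (0 : CSpace n) 1) :
    HasRemezDegree V (fun x => ‖f (φ x)‖) d := by
  intro a u hu s y hs hy α β hα hβ hβs
  set ι : ℝ →ᵃ[ℝ] CSpace n := φ.toAffineMap.comp (AffineMap.lineMap a (a + u)) with hι
  have hιt : ∀ t : ℝ, ι t = φ (a + t • u) := fun t => by
    change φ (AffineMap.lineMap a (a + u) t) = _
    rw [AffineMap.lineMap_apply]
    simp [add_comm]
  have hiso : Isometry ι := by
    refine Isometry.of_dist_eq fun t t' => ?_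
    rw [hιt, hιt, φ.dist_map, dist_add_left, dist_eq_norm, ← sub_smul, norm_smul, hu, mul_one]
    rfl
  have hline : ∀ t ∈ uIcc s y, a + t • u ∈ V := by
    intro t ht
    rw [← segment_eq_uIcc] at ht
    have : Convex ℝ ((fun t : ℝ => a + t • u) ⁻¹' V) := by
      have : (fun t : ℝ => a + t • u) = AffineMap.lineMap a (a + u) := by
        ext t : 1; simp [AffineMap.lineMap_apply, add_comm]
      rw [this]
      exact hV.affine_preimage _
    exact this.segment_subset hs hy ht
  have hseg : segment ℝ (ι s) (ι y) = ι '' uIcc s y := by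
    rw [← image_segment, segment_eq_uIcc]
  have hball : segment ℝ (ι s) (ι y) ⊆ ball 0 1 := by
    rw [hseg]
    rintro _ ⟨t, ht, rfl⟩
    rw [hιt]
    exact hφV _ (hline t ht)
  have hfc : ContinuousOn (fun z => ‖f z‖) (segment ℝ (ι s) (ι y)) := (hf.mono hball).norm
  set W := {t | t ∈ uIcc s y ∧ ‖f (φ (a + t • u))‖ ≤ α} with hW
  have hWc : IsCompact W := by
    have hc : ContinuousOn (fun t => ‖f (ι t)‖) (uIcc s y) :=
      hfc.comp hiso.continuous.continuousOn fun t ht => by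
        rw [hseg]; exact mem_image_of_mem _ ht
    have : W = uIcc s y ∩ (fun t => ‖f (ι t)‖) ⁻¹' Iic α := by
      ext t; simp only [hW, mem_ofPred_eq, mem_inter_iff, mem_preimage, mem_Iic, hιt]
    rw [this]
    exact isCompact_uIcc.of_isClosed_subset
      (hc.preimage_isClosed_of_isClosed isCompact_uIcc.isClosed isClosed_Iic) inter_subset_left
  have hvol : μH[1] (ι '' W) = volume W := by
    rw [hiso.hausdorffMeasure_image (.inl zero_le_one), hausdorffMeasure_real]
  rcases eq_or_ne (volume W) 0 with h0 | h0
  · rw [h0]; exact zero_le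
  have hWt : volume W ≠ ⊤ := hWc.measure_lt_top.ne
  have hw : 0 < (volume W).toReal := ENNReal.toReal_pos h0 hWt
  have key := hR (ι s) (ι y) hball (ι '' W) (by rw [hseg]; exact image_mono fun t ht => ht.1)
    (hWc.image hiso.continuous).measurableSet (by rw [hvol]; exact pos_iff_ne_zero.2 h0)
  rw [hvol, hiso.dist_eq, Real.dist_eq, abs_sub_comm] at key
  have h1 : β ≤ sSup ((fun z => ‖f z‖) '' segment ℝ (ι s) (ι y)) := by
    refine hβs.trans (le_csSup ?_ ⟨ι s, left_mem_segment _ _ _, by simp [hιt]⟩)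
    have hcs : IsCompact (segment ℝ (ι s) (ι y)) := by
      rw [hseg]; exact isCompact_uIcc.image hiso.continuous
    exact (hcs.image_of_continuousOn hfc).bddAbove
  have h2 : sSup ((fun z => ‖f z‖) '' (ι '' W)) ≤ α := by
    refine Real.sSup_le ?_ hα.le
    rintro _ ⟨_, ⟨t, ht, rfl⟩, rfl⟩
    have := ht.2
    rwa [← hιt] at this
  set w := (volume W).toReal
  have h3 : β ≤ (4 * |y - s| / w) ^ d * α := (h1.trans key).trans (by gcongr)
  rw [← ENNReal.ofReal_toReal hWt]
  apply ENNReal.ofReal_le_ofReal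
  have h4 : (β / α) ^ (1 / d) ≤ 4 * |y - s| / w := by
    have : β / α ≤ (4 * |y - s| / w) ^ d := (div_le_iff₀ hα).2 h3
    calc (β / α) ^ (1 / d) ≤ ((4 * |y - s| / w) ^ d) ^ (1 / d) := by gcongr
      _ = _ := by
        rw [← Real.rpow_mul (by positivity), mul_one_div_cancel hd.ne', Real.rpow_one]
  have h5 : (α / β) ^ (1 / d) = ((β / α) ^ (1 / d))⁻¹ := by
    rw [← Real.inv_rpow (by positivity), inv_div]
  have h6 : 0 < (β / α) ^ (1 / d) := by positivity
  rw [le_div_iff₀ hw] at h4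
  rw [h5, mul_right_comm, ← div_eq_mul_inv, le_div_iff₀ h6]
  change w * _ ≤ _
  linarith

/-- A function with a Remez inequality that is not identically zero on `V` is not almost everywhere
zero with respect to a log-concave probability measure on `V`. -/
lemma HasRemezDegree.exists_measure_ne_zero {k : ℕ} {H : RSpace k → ℝ≥0∞} (hH : IsLogConcave H)
    {V : Set (RSpace k)} (hVm : MeasurableSet V) (hHV : ∀ x, x ∉ V → H x = 0)
    (hV1 : volume.withDensity H V = 1)
    {G : RSpace k → ℝ} (hG : ContinuousOn G V) (hG0 : ∀ x, 0 ≤ G x) {d : ℝ} (hd : 0 < d)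
    (hR : HasRemezDegree V G d) {x₀ : RSpace k} (hx₀ : x₀ ∈ V) (hGx₀ : G x₀ ≠ 0) :
    ∃ β : ℝ, 0 < β ∧ volume.withDensity H {x | x ∈ V ∧ β ≤ G x} ≠ 0 := by
  by_contra! hcon
  set P := {x | 0 < H x} with hP
  have hPV : P ⊆ V := fun x (hx : 0 < H x) => by
    by_contra hc; simp [hHV x hc] at hx
  have hPc : Convex ℝ P := hH.convex_lt 0
  -- A convex set with empty interior lies in its frontier, which is null, and `H` would have
  -- integral zero.
  have hPint : (interior P).Nonempty := by
    by_contra hc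
    have h0 : volume P = 0 := by
      refine measure_mono_null (subset_closure.trans ?_) (hPc.addHaar_frontier volume)
      rw [frontier, not_nonempty_iff_eq_empty.1 hc, sdiff_empty]
    rw [withDensity_apply _ hVm] at hV1
    have : ∀ᵐ x ∂(volume : Measure (RSpace k)), H x = 0 := by
      rw [ae_iff]
      simpa [hP, pos_iff_ne_zero] using h0
    rw [lintegral_congr_ae (ae_restrict_of_ae this)] at hV1
    simp at hV1
  have hzero : ∀ z ∈ interior P, G z = 0 := by
    intro z hz
    by_contra hGz
    have hGz : 0 < G z := lt_of_le_of_ne (hG0 z) (Ne.symm hGz)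
    have hGcz : ContinuousAt G z :=
      hG.continuousAt (Filter.mem_of_superset (mem_interior_iff_mem_nhds.1 hz) hPV)
    have hU : {x | x ∈ interior P ∧ G z / 2 < G x} ∈ nhds z :=
      Filter.inter_mem (isOpen_interior.mem_nhds hz)
        (hGcz.eventually (lt_mem_nhds (half_lt_self hGz)))
    obtain ⟨U, hUsub, hUo, hzU⟩ := _root_.mem_nhds_iff.1 hU
    have hμU : volume.withDensity H U = 0 := by
      refine measure_mono_null (fun x hx => ?_) (hcon (G z / 2) (by linarith))
      exact ⟨hPV (interior_subset (hUsub hx).1), (hUsub hx).2.le⟩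
    rw [withDensity_apply _ hUo.measurableSet] at hμU
    have hae := (lintegral_eq_zero_iff' hH.aemeasurable.restrict).1 hμU
    have : ∀ᵐ x ∂volume.restrict U, False := by
      filter_upwards [hae, ae_restrict_mem hUo.measurableSet] with x hx hxU
      have hxP : x ∈ P := interior_subset (hUsub hxU).1
      exact (show 0 < H x from hxP).ne' hx
    rw [ae_iff] at this
    simp [(hUo.measure_pos volume ⟨z, hzU⟩).ne'] at this
  obtain ⟨z, hz⟩ := hPint
  have hzV : z ∈ V := hPV (interior_subset hz)
  have hne : x₀ - z ≠ 0 := by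
    intro h
    rw [sub_eq_zero.1 h] at hGx₀
    exact hGx₀ (hzero z hz)
  set L := ‖x₀ - z‖
  have hL : 0 < L := norm_pos_iff.2 hne
  set u := L⁻¹ • (x₀ - z) with hu
  have hu1 : ‖u‖ = 1 := by
    rw [hu, norm_smul, norm_inv, Real.norm_of_nonneg hL.le, inv_mul_cancel₀ hL.ne']
  have hzu : z + L • u = x₀ := by
    rw [hu, smul_smul, mul_inv_cancel₀ hL.ne', one_smul]; abel
  have hGpos : 0 < G x₀ := lt_of_le_of_ne (hG0 _) (Ne.symm hGx₀)
  have hcont : Continuous fun t : ℝ => z + t • u := by fun_prop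
  have hnhds : (fun t : ℝ => z + t • u) ⁻¹' interior P ∈ nhds (0 : ℝ) :=
    hcont.continuousAt.preimage_mem_nhds (by simpa using isOpen_interior.mem_nhds hz)
  obtain ⟨ε, hε, hεP⟩ := Metric.mem_nhds_iff.1 hnhds
  set c := min (ε / 2) L with hc
  have hc0 : 0 < c := lt_min (by linarith) hL
  have hcε : c < ε := (min_le_left _ _).trans_lt (by linarith)
  -- `G` vanishes on an initial interval of length `c` of the segment from `z` to `x₀`, so the
  -- sublevel estimate holds there with threshold `G x₀ / T ^ d` for every `T`; letting `T` grow
  -- contradicts `c > 0`.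
  have hle : ∀ T : ℝ, 0 < T → c ≤ 4 * L / T := by
    intro T hT
    have hTd : 0 < T ^ d := by positivity
    have := hR z u hu1 L 0 (by rwa [hzu]) (by simpa using hzV) (G x₀ / T ^ d) (G x₀)
      (by positivity) hGpos (by rw [hzu])
    have hsub : Icc 0 c ⊆ {t | t ∈ uIcc L 0 ∧ G (z + t • u) ≤ G x₀ / T ^ d} := by
      intro t ht
      refine ⟨?_, ?_⟩
      · rw [uIcc_of_ge hL.le]
        exact ⟨ht.1, ht.2.trans (min_le_right _ _)⟩
      · rw [hzero _ (hεP (by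
          rw [mem_ball, Real.dist_eq, sub_zero, abs_of_nonneg ht.1]
          exact ht.2.trans_lt hcε))]
        positivity
    have h1 := (measure_mono hsub).trans this
    rw [Real.volume_Icc, sub_zero, zero_sub, abs_neg, abs_of_pos hL, div_right_comm, div_self hGpos.ne', one_div,
      Real.inv_rpow (by positivity), ← Real.rpow_mul hT.le, mul_one_div_cancel hd.ne',
      Real.rpow_one, ENNReal.ofReal_le_ofReal_iff (by positivity)] at h1
    rw [div_eq_mul_inv]; linarith
  have := hle (8 * L / c) (by positivity)
  have e : 4 * L / (8 * L / c) = c / 2 := by field_simp; norm_num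
  rw [e] at this
  linarith

theorem mainTheorem2 :
    ∃ c₁ c₂ C : ℝ, 0 < c₁ ∧ 0 < c₂ ∧ 0 < C ∧
      ∀ (n k : ℕ)
        -- an isometric copy of `ℝᵏ` in `ℂⁿ`, that is, a `k`-dimensional real affine subspace
        (φ : RSpace k →ᵃⁱ[ℝ] CSpace n)
        -- a `k`-dimensional convex body inside the unit ball
        (V : Set (RSpace k)), Convex ℝ V → IsCompact V → (interior V).Nonempty →
        (∀ x ∈ V, φ x ∈ ball (0 : CSpace n) 1) →
        ∀ h : RSpace k → ℝ, LogConcave h → (∀ x, x ∉ V → h x = 0) →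
        densityMeasure h V = 1 →
        ∀ (r : ℝ), 1 < r →
        ∀ f : CSpace n → ℂ, DifferentiableOn ℂ f (ball 0 r) →
        (∃ z ∈ ball (0 : CSpace n) r, ∃ w ∈ ball (0 : CSpace n) r, f z ≠ f w) →
        (∀ α : ℝ, 0 < α →
          densityMeasure h {x | x ∈ V ∧
              α * geometricMean ((densityMeasure h).restrict V) (fun y => ‖f (φ y)‖) < ‖f (φ x)‖} ≤
            ENNReal.ofReal (C * Real.exp (-c₁ * α ^ (1 / chebyshevDegree f)))) ∧
        ((∃ x ∈ V, f (φ x) ≠ 0) →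
          ∀ α : ℝ, 0 < α → α ≤ Real.exp (-1) →
          densityMeasure h {x | x ∈ V ∧
              ‖f (φ x)‖ ≤ α * geometricMean ((densityMeasure h).restrict V) (fun y => ‖f (φ y)‖)} ≤
            ENNReal.ofReal (C * (c₂ * α) ^ (1 / chebyshevDegree f) *
              (Real.log (1 / α)) ^ (1 / 2 : ℝ))) := by
  refine ⟨Real.exp (-3500) / 192, 1, 400 * Real.exp 3500, by positivity, one_pos, by positivity, ?_⟩
  intro n k φ V hVc hV _ hφV h hh hhV hV1 r hr f hf _
  have hc1 : Real.exp (-3500) / 192 ≤ 1 := by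
    have : Real.exp (-3500) ≤ 1 := Real.exp_le_one_iff.2 (by norm_num)
    linarith
  have hC : (400 : ℝ) ≤ 400 * Real.exp 3500 := by
    have : 1 ≤ Real.exp 3500 := Real.one_le_exp (by norm_num)
    linarith
  set H : RSpace k → ℝ≥0∞ := fun x => ENNReal.ofReal (h x) with hHdef
  set μ := densityMeasure h with hμ
  have hμH : μ = volume.withDensity H := rfl
  have hHV : ∀ x, x ∉ V → H x = 0 := fun x hx => by simp [hHdef, hhV x hx]
  have hVcompl : μ Vᶜ = 0 := by
    rw [hμH, withDensity_apply _ hV.measurableSet.compl,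
      setLIntegral_congr_fun hV.measurableSet.compl (g := fun _ => 0) fun x hx => hHV x hx]
    simp
  have hprob : IsProbabilityMeasure μ := by
    refine ⟨?_⟩
    rw [← measure_add_measure_compl hV.measurableSet, hV1, hVcompl, add_zero]
  have haeV : ∀ᵐ x ∂μ, x ∈ V := by rw [ae_iff]; exact hVcompl
  have hlog1 : ∀ α : ℝ, 0 < α → α ≤ Real.exp (-1) → 1 ≤ (Real.log (1 / α)) ^ (1 / 2 : ℝ) := by
    intro α hα hα1
    have : Real.log α ≤ -1 := by
      rw [← Real.log_exp (-1)]; exact Real.log_le_log hα hα1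
    refine Real.one_le_rpow ?_ (by norm_num)
    rw [one_div, Real.log_inv]; linarith
  have hd0 : 0 ≤ chebyshevDegree f := Real.sInf_nonneg fun d hd => hd.1.le
  -- In degree `0`, also the value when no exponent is admissible, `1 / 0 = 0` makes both powers
  -- `1`, and the claimed bounds exceed `1`.
  rcases hd0.eq_or_lt with hd | hd
  · rw [← hd]
    simp only [div_zero, Real.rpow_zero, mul_one]
    refine ⟨fun α _ => prob_le_one.trans ?_, fun _ α hα hα1 => prob_le_one.trans ?_⟩
    · rw [ENNReal.one_le_ofReal]
      have h1 : Real.exp (-1) ≤ Real.exp (-(Real.exp (-3500) / 192)) :=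
        Real.exp_le_exp.2 (by linarith)
      have h2 : (1 : ℝ) / 3 ≤ Real.exp (-1) := by
        rw [Real.exp_neg, one_div]
        exact inv_anti₀ (Real.exp_pos 1) (by linarith [Real.exp_one_lt_d9])
      nlinarith
    · rw [ENNReal.one_le_ofReal]
      nlinarith [hlog1 α hα hα1]
  set d := chebyshevDegree f
  set G : RSpace k → ℝ := fun x => ‖f (φ x)‖ with hG
  have hfc : ContinuousOn f (ball 0 1) := hf.continuousOn.mono (ball_subset_ball hr.le)
  have hR : HasRemezDegree V G d :=
    (remezBound_chebyshevDegree hd).hasRemezDegree hfc hd φ hVc hφV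
  have hGc : ContinuousOn G V := (hfc.comp φ.continuous.continuousOn hφV).norm
  have hG0 : ∀ x, 0 ≤ G x := fun x => norm_nonneg _
  by_cases hex : ∃ x ∈ V, f (φ x) ≠ 0
  · obtain ⟨x₀, hx₀, hfx₀⟩ := hex
    -- `G` is only known to be continuous on `V`; its extension by zero is measurable and agrees
    -- with it almost everywhere.
    set g : RSpace k → ℝ := V.indicator G with hg
    have hgG : ∀ x ∈ V, g x = G x := fun x hx => indicator_of_mem hx _
    have hgm : Measurable g := by
      classical
      rw [hg, ← piecewise_eq_indicator]
      exact hGc.measurable_piecewise continuousOn_const hV.measurableSet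
    have hset : ∀ p : ℝ → Prop, μ {x | x ∈ V ∧ p (G x)} = μ {x | p (g x)} := by
      intro p
      refine measure_congr ?_
      filter_upwards [haeV] with x hx
      refine propext ⟨fun hx' => ?_, fun hx' => ⟨hx, ?_⟩⟩
      · change p (g x)
        rw [hgG x hx]; exact hx'.2
      · have hx' : p (g x) := hx'
        rwa [hgG x hx] at hx'
    obtain ⟨β₀, hβ₀, hne⟩ := hR.exists_measure_ne_zero hh.isLogConcave hV.measurableSet hHV hV1
      hGc hG0 hd hx₀ (by simpa [hG] using hfx₀)
    have hprob' : IsProbabilityMeasure (volume.withDensity H) := hprob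
    obtain ⟨hz, hint, hdev⟩ := deviation_of_dilation (μ := μ) hgm
      (fun x => indicator_nonneg (fun x _ => hG0 x) x) hd (fun α β hα hβ => by
        have := hR.measure_le hh.isLogConcave hV hVc hV1 hGc hd hα hβ
        rw [← hset (fun t => β ≤ t), ← hset (fun t => t ≤ α)]
        exact this) ⟨β₀, hβ₀, by rw [← hset (fun t => β₀ ≤ t)]; exact hne⟩
    have hrestr : μ.restrict V = μ := Measure.restrict_eq_self_of_ae_mem haeV
    have hlogae : (fun x => Real.log (g x)) =ᵐ[μ] fun x => Real.log (G x) := by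
      filter_upwards [haeV] with x hx
      rw [hgG x hx]
    have hgm : geometricMean (μ.restrict V) G = Real.exp (∫ x, Real.log (g x) ∂μ) := by
      rw [hrestr, geometricMean, if_pos, integral_congr_ae hlogae]
      refine ⟨?_, hint.congr hlogae⟩
      have : ∀ᵐ x ∂μ, ¬ g x ≤ 0 := by rw [ae_iff]; simpa using hz
      filter_upwards [this, haeV] with x hx hxV h0
      rw [hgG x hxV, h0] at hx
      exact hx le_rfl
    rw [hgm]
    refine ⟨fun α hα => ?_, fun _ α hα hα1 => ?_⟩
    · have h1 := hset fun t => α * Real.exp (∫ x, Real.log (g x) ∂μ) ≤ t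
      refine (measure_mono (t := {x | x ∈ V ∧ α * Real.exp (∫ x, Real.log (g x) ∂μ) ≤ G x})
        fun x hx => ⟨hx.1, hx.2.le⟩).trans (h1.le.trans ((hdev α hα).1.trans ?_))
      apply ENNReal.ofReal_le_ofReal
      gcongr
      linarith
    · have h1 := hset fun t => t ≤ α * Real.exp (∫ x, Real.log (g x) ∂μ)
      refine h1.le.trans ((hdev α hα).2.trans (ENNReal.ofReal_le_ofReal ?_))
      rw [one_mul]
      -- For `α ≤ 1/e` the logarithmic factor is at least `1` and only weakens the bound.
      exact le_mul_of_one_le_right (by positivity) (hlog1 α hα hα1)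
  · refine ⟨fun α hα => ?_, fun h => absurd h hex⟩
    push Not at hex
    -- When `f` vanishes on `V`, the strict inequality fails everywhere, since the geometric mean is
    -- nonnegative.
    have hempty : {x | x ∈ V ∧ α * geometricMean (μ.restrict V) G < G x} = ∅ := by
      ext x
      simp only [mem_ofPred_eq, mem_empty_iff_false, iff_false, not_and, not_lt]
      intro hx
      have : G x = 0 := by simp [hG, hex x hx]
      rw [this]
      refine mul_nonneg hα.le ?_
      unfold geometricMean
      split_ifs
      · positivity
      · exact le_rfl
    rw [hempty]
    simp
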